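/- Let $G=(V,E)$ be a finite graph (parallel edges and loops allowed). Each edge consists of two half-edges; let $\mathcal{E}$ be the set of half-edges, $n=|\mathcal{E}|=2|E|$, and let $\mathcal{E}(v)$ be the set of half-edges at the vertex $v$. For every $v\in V$ let $f_v:\{0,1\}^{\mathcal{E}(v)}\to\mathbb{R}_{\ge 0}$ be windable. Here a function $F:\{0,1\}^J\to\mathbb{R}_{\ge0}$ ($J$ finite) is \emph{windable} if there are values $B(x,y,M)\ge 0$, for $x,y\in\{0,1\}^J$ and $M\in\mathcal{M}_{x\oplus y}$, such that $F(x)F(y)=\sum_{M\in\mathcal{M}_{x\oplus y}}B(x,y,M)$ for all $x,y$, and $B(x,y,M)=B(x\oplus S,y\oplus S,M)$ for all $x,y$ and all $S\in M\in\mathcal{M}_{x\oplus y}$, where $\mathcal{M}_z$ is the set of partitions of $\{i: z_i=1\}$ into pairs and at most one singleton, and $x\oplus S$ is $x$ with the entries in $S$ flipped. For $\sigma\in\{0,1\}^{\mathcal{E}}$ put $w(\sigma)=\prod_{v\in V}f_v(\sigma|_{\mathcal{E}(v)})$. Let $\Omega_k$ be the set of $\sigma\in\{0,1\}^{\mathcal{E}}$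 for which exactly $k$ edges have different values on their two half-edges, $Z_k=\sum_{\sigma\in\Omega_k}w(\sigma)$, $\Omega=\Omega_0\cup\Omega_2$, $\mu(\sigma)=w(\sigma)/(Z_0+Z_2)$ for $\sigma\in\Omega$, and $\mu(\Omega_0)=\sum_{\sigma\in\Omega_0}\mu(\sigma)$. With $d$ the Hamming distance, define for $\sigma,\pi\in\Omega$ \[ P'(\sigma,\pi)=\begin{cases}\frac{2}{n^2}\min\left(1,\frac{w(\pi)}{w(\sigma)}\right)&\text{if } d(\sigma,\pi)=2,\\ 1-\frac{2}{n^2}\sum_{\rho\in\Omega:\,d(\sigma,\rho)=2}\min\left(1,\frac{w(\rho)}{w(\sigma)}\right)&\text{if }\sigma=\pi,\\ 0&\text{otherwise}\end{cases} \] (configurations of weight $0$ are made absorbing), and let $P=\frac12(I+P')$ be its lazy version. Then $P$ is a stochastic matrix with $\mu P=\mu$, and for every $\sigma\in\Omega$ with $w(\sigma)>0$ and every integer $t\ge 0$, \[ \left\|P^t(\sigma,\cdot)-\mu\right\|_{TV}\le\frac12\,\mu(\sigma)^{-1/2}\exp\left(-t\cdot\mu(\Omega_0)^2/n^4\right), \]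 where $\|p-q\|_{TV}=\frac12\sum_{\pi\in\Omega}|p(\pi)-q(\pi)|$ (and the exponential is read as $1$ if $n=0$). -/

import Mathlib

open scoped Matrix

noncomputable section

namespace Holant

/-- Flip the values of `x` at the positions in `S`, written `x ⊕ S`. -/
def flip {J : Type*} [DecidableEq J] (x : J → Bool) (S : Finset J) : J → Bool :=
  fun i => if i ∈ S then !(x i) else x i

/-- The positions where `x` and `y` differ, i.e. the support of `x ⊕ y`. -/
def diff {J : Type*} [Fintype J] (x y : J → Bool) : Finset J :=
  {i | x i ≠ y i}

/-- `M` is a partition of the finite set `A` into pairs and at most one singleton. -/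
def IsPairing {J : Type*} [DecidableEq J] (A : Finset J) (M : Finset (Finset J)) : Prop :=
  (M : Set (Finset J)).PairwiseDisjoint id ∧ M.biUnion id = A ∧
    (∀ S ∈ M, S.card = 1 ∨ S.card = 2) ∧ (M.filter fun S => S.card = 1).card ≤ 1

open Classical in
/-- The set of all partitions of `A` into pairs and at most one singleton. -/
def pairings {J : Type*} [Fintype J] [DecidableEq J] (A : Finset J) :
    Finset (Finset (Finset J)) :=
  {M | IsPairing A M}

/-- Windability of a nonnegative function on `{0,1}^J`: `F x * F y` splits as a sum of nonnegative
values `B x y M` over the pairings `M` of `x ⊕ y`, which are invariant under flipping a block of `M`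
in both `x` and `y`. -/
def Windable {J : Type*} [Fintype J] [DecidableEq J] (F : (J → Bool) → ℝ) : Prop :=
  ∃ B : (J → Bool) → (J → Bool) → Finset (Finset J) → ℝ,
    (∀ x y, ∀ M ∈ pairings (diff x y), 0 ≤ B x y M) ∧
    (∀ x y, F x * F y = ∑ M ∈ pairings (diff x y), B x y M) ∧
    (∀ x y, ∀ M ∈ pairings (diff x y), ∀ S ∈ M, B x y M = B (flip x S) (flip y S) M)

/-- A Holant instance on a graph with vertices `V` and edges `E` (parallel edges and loops are
allowed). The edge `e` has the two half-edges `(e, false)` and `(e, true)`; the half-edge `(e, b)`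
sits at the vertex `endpoint (e, b)`. The constraint at `v` is a nonnegative function of the values
of the half-edges at `v`. -/
structure Instance (V E : Type*) where
  endpoint : E × Bool → V
  f : (v : V) → ({h : E × Bool // endpoint h = v} → Bool) → ℝ
  f_nonneg : ∀ v x, 0 ≤ f v x

/-- Assignments of bits to the half-edges. -/
abbrev Config (E : Type*) := E × Bool → Bool

/-- The number of edges whose two half-edges carry different values. -/
def disagreements {E : Type*} [Fintype E] (σ : Config E) : ℕ :=
  (Finset.univ.filter fun e : E => σ (e, false) ≠ σ (e, true)).card

/-- The state space `Ω = Ω₀ ∪ Ω₂`, where `Ω_k` consists of the configurations with exactly `k`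
disagreeing edges. -/
abbrev State (E : Type*) [Fintype E] :=
  {σ : Config E // disagreements σ = 0 ∨ disagreements σ = 2}

/-- The number `n` of half-edges. -/
def numHalfEdges (E : Type*) [Fintype E] : ℕ := Fintype.card (E × Bool)

namespace Instance

variable {V E : Type*} [Fintype V] [Fintype E] [DecidableEq E] (Λ : Instance V E)

/-- The weight `w(σ) = ∏_v f_v(σ restricted to the half-edges at v)`. -/
def weight (σ : Config E) : ℝ := ∏ v, Λ.f v fun h => σ h.1

/-- `Z k` is the total weight of `Ω_k`. -/
def Z (k : ℕ) : ℝ := ∑ σ : Config E with disagreements σ = k, Λ.weight σ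

/-- The distribution `μ(σ) = w(σ) / (Z₀ + Z₂)` on `Ω`. -/
def μ (σ : State E) : ℝ := Λ.weight σ.1 / (Λ.Z 0 + Λ.Z 2)

/-- `μ(Ω₀)`. -/
def μΩ₀ : ℝ := ∑ σ : State E with disagreements σ.1 = 0, Λ.μ σ

/-- The Metropolis chain `P'` on `Ω` that flips two half-edges.
(A configuration of weight `0` is absorbing: the quotients are then `0`.) -/
def metropolis : Matrix (State E) (State E) ℝ := fun σ π =>
  if hammingDist σ.1 π.1 = 2 then
    2 / (numHalfEdges E : ℝ) ^ 2 * min 1 (Λ.weight π.1 / Λ.weight σ.1)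
  else if σ = π then
    1 - 2 / (numHalfEdges E : ℝ) ^ 2 *
      ∑ ρ : State E with hammingDist σ.1 ρ.1 = 2, min 1 (Λ.weight ρ.1 / Λ.weight σ.1)
  else 0

/-- The lazy version `P` of `P'`. -/
def lazyChain : Matrix (State E) (State E) ℝ := fun σ π =>
  if σ = π then (1 + Λ.metropolis σ π) / 2 else Λ.metropolis σ π / 2

end Instance

/-- Total variation distance between two functions on a finite set. -/
def tvDist {α : Type*} [Fintype α] (p q : α → ℝ) : ℝ := (1 / 2) * ∑ a, |p a - q a|

end Holant

end

/-!
Multiplying the windings of the vertex constraints splits `w x * w y`, for `x ∈ Ω₀` and `y ∈ Ω`,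
over the matchings `M` of `x ⊕ y` into pairs of half-edges, and the summands do not change when a
block of `M` is flipped in both configurations. The blocks of `M` can be ordered so that every
initial segment splits at most two edges, and flipping them in this order leads from `x` to `y`
inside `Ω`. By the invariance, the flow through a move from `a` to `a ⊕ S` is a sum of parts of
`w a * w (a ⊕ M)`, and also of `w (a ⊕ S) * w (a ⊕ S ⊕ M)`, where the complementary configurations
lie in `Ω₀ ∪ Ω₂ ∪ Ω₄`. A matching that splits four edges can be cut into two parts that split two
edges each, whence `Z₀ Z₄ ≤ Z₂²`; this bounds the congestion. As the paths have at most `n / 2`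
moves, the Cauchy–Schwarz inequality gives a Poincaré inequality, even with `n³` in place of `n⁴`.
The lazy chain is reversible and positive semidefinite, so it contracts the `L²` norm of functions
of mean zero accordingly, and the `L²` norm of the density bounds the total variation distance.
-/

namespace Holant

open Finset

section ReversibleChain

variable {α : Type*} [Fintype α]

lemma sq_dotProduct_le {μ : α → ℝ} (hμ : ∀ a, 0 ≤ μ a) (hμ1 : ∑ a, μ a = 1) (g : α → ℝ) :
    (μ ⬝ᵥ g) ^ 2 ≤ μ ⬝ᵥ g ^ 2 :=
  Real.pow_arith_mean_le_arith_mean_pow_of_even univ μ g (fun a _ => hμ a) hμ1 even_two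

lemma dotProduct_mul_mulVec (μ : α → ℝ) (K : Matrix α α ℝ) (u v : α → ℝ) :
    μ ⬝ᵥ (u * K *ᵥ v) = ∑ a, ∑ b, μ a * K a b * (u a * v b) := by
  simp only [dotProduct, Pi.mul_apply, Matrix.mulVec, mul_sum]
  exact sum_congr rfl fun a _ => sum_congr rfl fun b _ => by ring

variable [DecidableEq α]

/-- `K` is a stochastic matrix satisfying the detailed balance equations with respect to `μ`. The
weights `μ` need not be normalised. -/
structure IsReversible (μ : α → ℝ) (K : Matrix α α ℝ) : Prop where
  stochastic : K ∈ Matrix.rowStochastic ℝ α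
  balance : ∀ a b, μ a * K a b = μ b * K b a

/-- The Dirichlet form `½ ∑ μ(a) K(a, b) (f(b) - f(a))²` of the chain `K` with stationary weights
`μ`, the quantity that a Poincaré inequality compares with the variance of `f`. -/
noncomputable def dirichletForm (μ : α → ℝ) (K : Matrix α α ℝ) (f : α → ℝ) : ℝ :=
  1 / 2 * ∑ a, ∑ b, μ a * K a b * (f b - f a) ^ 2

/-- The Poincaré inequality with constant `γ`: the variance of `f` times `γ` is at most the
Dirichlet form. It is stated for functions of mean zero, whose variance is `μ ⬝ᵥ f ^ 2`. -/
def PoincareInequality (μ : α → ℝ) (K : Matrix α α ℝ) (γ : ℝ) : Prop :=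
  ∀ f : α → ℝ, μ ⬝ᵥ f = 0 → γ * (μ ⬝ᵥ f ^ 2) ≤ dirichletForm μ K f

namespace IsReversible

variable {μ : α → ℝ} {K Q : Matrix α α ℝ}

lemma vecMul_eq (h : IsReversible μ K) : μ ᵥ* K = μ := by
  ext b
  calc ∑ a, μ a * K a b = μ b * ∑ a, K b a := by
        rw [mul_sum]; exact sum_congr rfl fun a _ => h.balance a b
    _ = μ b := by rw [Matrix.sum_row_of_mem_rowStochastic h.stochastic, mul_one]

lemma dotProduct_mulVec (h : IsReversible μ K) (u : α → ℝ) : μ ⬝ᵥ K *ᵥ u = μ ⬝ᵥ u := by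
  rw [Matrix.dotProduct_mulVec, h.vecMul_eq]

lemma dotProduct_mul_mulVec_comm (h : IsReversible μ K) (u v : α → ℝ) :
    μ ⬝ᵥ (u * K *ᵥ v) = μ ⬝ᵥ (v * K *ᵥ u) := by
  rw [dotProduct_mul_mulVec, dotProduct_mul_mulVec, sum_comm]
  refine sum_congr rfl fun a _ => sum_congr rfl fun b _ => ?_
  rw [h.balance]; ring

lemma pow (h : IsReversible μ K) (t : ℕ) : IsReversible μ (K ^ t) := by
  refine ⟨pow_mem h.stochastic t, fun a b => ?_⟩
  have hK : Matrix.diagonal μ * K = Kᵀ * Matrix.diagonal μ := by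
    ext a b; simp [h.balance a b, mul_comm]
  have hKt : SemiconjBy (Matrix.diagonal μ) (K ^ t) (Kᵀ ^ t) := SemiconjBy.pow_right hK t
  simpa [← Matrix.transpose_pow, mul_comm] using congrFun₂ hKt.eq a b

lemma half_one_add (h : IsReversible μ Q) : IsReversible μ ((1 / 2 : ℝ) • (1 + Q)) := by
  refine ⟨?_, fun a b => ?_⟩
  · rw [smul_add]
    exact Matrix.convex_rowStochastic (one_mem _) h.stochastic
      (by norm_num) (by norm_num) (by norm_num)
  · have := h.balance a b
    rcases eq_or_ne a b with rfl | hab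
    · rfl
    · simp only [Matrix.smul_apply, Matrix.add_apply, Matrix.one_apply_ne hab,
        Matrix.one_apply_ne hab.symm, smul_eq_mul]
      linarith

lemma sum_mul_add_mul_sq (h : IsReversible μ K) (f : α → ℝ) (c : ℝ) :
    ∑ a, ∑ b, μ a * K a b * (f b + c * f a) ^ 2 =
      (1 + c ^ 2) * (μ ⬝ᵥ f ^ 2) + 2 * c * (μ ⬝ᵥ (f * K *ᵥ f)) := by
  have hin : μ ⬝ᵥ (1 * K *ᵥ f ^ 2) = μ ⬝ᵥ f ^ 2 := by
    rw [one_mul, h.dotProduct_mulVec]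
  have hout : μ ⬝ᵥ (f ^ 2 * K *ᵥ 1) = μ ⬝ᵥ f ^ 2 := by
    rw [h.dotProduct_mul_mulVec_comm, hin]
  rw [add_mul, one_mul]
  nth_rewrite 1 [← hin]
  rw [← hout]
  simp only [dotProduct_mul_mulVec, mul_sum, ← sum_add_distrib]
  exact sum_congr rfl fun a _ => sum_congr rfl fun b _ => by
    simp only [Pi.pow_apply, Pi.one_apply]; ring

lemma dirichletForm_eq (h : IsReversible μ K) (f : α → ℝ) :
    dirichletForm μ K f = μ ⬝ᵥ f ^ 2 - μ ⬝ᵥ (f * K *ᵥ f) := by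
  have := h.sum_mul_add_mul_sq f (-1)
  simp only [neg_one_mul, ← sub_eq_add_neg] at this
  rw [dirichletForm, this]; ring

lemma dotProduct_mul_mulVec_half_one_add_nonneg (h : IsReversible μ Q) (hμ : ∀ a, 0 ≤ μ a)
    (f : α → ℝ) : 0 ≤ μ ⬝ᵥ (f * ((1 / 2 : ℝ) • (1 + Q)) *ᵥ f) := by
  have hsq : μ ⬝ᵥ (f * ((1 / 2 : ℝ) • (1 + Q)) *ᵥ f) =
      1 / 4 * ∑ a, ∑ b, μ a * Q a b * (f b + 1 * f a) ^ 2 := by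
    rw [h.sum_mul_add_mul_sq, Matrix.smul_mulVec, Matrix.add_mulVec, Matrix.one_mulVec,
      mul_smul_comm, dotProduct_smul, mul_add, dotProduct_add, smul_eq_mul, ← sq]
    ring
  rw [hsq]
  exact mul_nonneg (by norm_num) <| sum_nonneg fun a _ => sum_nonneg fun b _ =>
    mul_nonneg (mul_nonneg (hμ a) (Matrix.nonneg_of_mem_rowStochastic h.stochastic)) (sq_nonneg _)

lemma sq_dotProduct_mul_mulVec_le (h : IsReversible μ K)
    (hpos : ∀ f, 0 ≤ μ ⬝ᵥ (f * K *ᵥ f)) (u v : α → ℝ) :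
    (μ ⬝ᵥ (u * K *ᵥ v)) ^ 2 ≤ (μ ⬝ᵥ (u * K *ᵥ u)) * (μ ⬝ᵥ (v * K *ᵥ v)) := by
  let B : LinearMap.BilinForm ℝ (α → ℝ) := LinearMap.mk₂ ℝ (fun u v => μ ⬝ᵥ (u * K *ᵥ v))
    (fun u u' v => by rw [add_mul, dotProduct_add])
    (fun c u v => by rw [smul_mul_assoc, dotProduct_smul])
    (fun u v v' => by rw [Matrix.mulVec_add, mul_add, dotProduct_add])
    (fun c u v => by rw [Matrix.mulVec_smul, mul_smul_comm, dotProduct_smul])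
  exact B.apply_sq_le_of_symm hpos ⟨h.dotProduct_mul_mulVec_comm⟩ u v

lemma dotProduct_mulVec_sq_le (h : IsReversible μ K) (hμ : ∀ a, 0 ≤ μ a)
    (hpos : ∀ f, 0 ≤ μ ⬝ᵥ (f * K *ᵥ f)) {γ : ℝ} (hγ : PoincareInequality μ K γ) {f : α → ℝ}
    (hf : μ ⬝ᵥ f = 0) : μ ⬝ᵥ (K *ᵥ f) ^ 2 ≤ Real.exp (-γ) ^ 2 * (μ ⬝ᵥ f ^ 2) := by
  have hsq : ∀ g : α → ℝ, 0 ≤ μ ⬝ᵥ g ^ 2 := fun g =>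
    sum_nonneg fun a _ => mul_nonneg (hμ a) (sq_nonneg (g a))
  have hgap : ∀ g : α → ℝ, μ ⬝ᵥ g = 0 → μ ⬝ᵥ (g * K *ᵥ g) ≤ Real.exp (-γ) * (μ ⬝ᵥ g ^ 2) := by
    intro g hg
    have := hγ g hg
    rw [h.dirichletForm_eq] at this
    nlinarith [mul_le_mul_of_nonneg_right (Real.one_sub_le_exp_neg γ) (hsq g)]
  have hcs : (μ ⬝ᵥ (K *ᵥ f) ^ 2) ^ 2 ≤
      (Real.exp (-γ) * (μ ⬝ᵥ f ^ 2)) * (Real.exp (-γ) * (μ ⬝ᵥ (K *ᵥ f) ^ 2)) := by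
    have := h.sq_dotProduct_mul_mulVec_le hpos (K *ᵥ f) f
    rw [← sq, mul_comm (μ ⬝ᵥ _)] at this
    exact this.trans <| mul_le_mul (hgap f hf) (hgap _ ((h.dotProduct_mulVec f).trans hf))
      (hpos _) ((hpos f).trans (hgap f hf))
  rcases (hsq (K *ᵥ f)).eq_or_lt with hzero | hlt
  · rw [← hzero]; exact mul_nonneg (sq_nonneg _) (hsq f)
  · exact le_of_mul_le_mul_right (by linarith) hlt

lemma dotProduct_pow_mulVec_sq_le (h : IsReversible μ K) (hμ : ∀ a, 0 ≤ μ a)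
    (hpos : ∀ f, 0 ≤ μ ⬝ᵥ (f * K *ᵥ f)) {γ : ℝ} (hγ : PoincareInequality μ K γ) {f : α → ℝ}
    (hf : μ ⬝ᵥ f = 0) (t : ℕ) :
    μ ⬝ᵥ ((K ^ t) *ᵥ f) ^ 2 ≤ (Real.exp (-γ) ^ 2) ^ t * (μ ⬝ᵥ f ^ 2) := by
  induction t with
  | zero => simp
  | succ t ih =>
    rw [pow_succ' K, ← Matrix.mulVec_mulVec, pow_succ' (Real.exp (-γ) ^ 2), mul_assoc]
    exact (h.dotProduct_mulVec_sq_le hμ hpos hγ (((h.pow t).dotProduct_mulVec f).trans hf)).trans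
      (mul_le_mul_of_nonneg_left ih (sq_nonneg _))

end IsReversible

/-- The density of the point mass at `σ` with respect to `μ`, minus its mean. Its images under the
powers of a reversible chain describe the deviation from `μ` of the chain started at `σ`. -/
noncomputable def centeredPointMass (μ : α → ℝ) (σ : α) : α → ℝ := Pi.single σ (μ σ)⁻¹ - 1

section CenteredPointMass

variable {μ : α → ℝ} {K : Matrix α α ℝ} {σ : α}

lemma dotProduct_centeredPointMass (hμ1 : ∑ a, μ a = 1) (hσ : μ σ ≠ 0) :
    μ ⬝ᵥ centeredPointMass μ σ = 0 := by
  rw [centeredPointMass, dotProduct_sub, dotProduct_single, dotProduct_one, hμ1,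
    mul_inv_cancel₀ hσ, sub_self]

lemma dotProduct_centeredPointMass_sq (hμ1 : ∑ a, μ a = 1) (hσ : μ σ ≠ 0) :
    μ ⬝ᵥ centeredPointMass μ σ ^ 2 = (μ σ)⁻¹ - 1 := by
  have hsq : centeredPointMass μ σ ^ 2 =
      (Pi.single σ ((μ σ)⁻¹ ^ 2 - 2 * (μ σ)⁻¹) : α → ℝ) + 1 := by
    ext a
    rcases eq_or_ne a σ with rfl | ha
    · simp only [centeredPointMass, Pi.pow_apply, Pi.sub_apply, Pi.add_apply, Pi.single_eq_same,
        Pi.one_apply]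
      ring
    · simp [centeredPointMass, Pi.single_eq_of_ne ha]
  rw [hsq, dotProduct_add, dotProduct_single, dotProduct_one, hμ1]
  field_simp
  ring

lemma IsReversible.tvDist_eq (h : IsReversible μ K) (hμ : ∀ a, 0 ≤ μ a) (hσ : μ σ ≠ 0) :
    tvDist (K σ) μ = 1 / 2 * (μ ⬝ᵥ |K *ᵥ centeredPointMass μ σ|) := by
  have happ : ∀ a, (K *ᵥ centeredPointMass μ σ) a = K a σ * (μ σ)⁻¹ - 1 := fun a => by
    rw [centeredPointMass, Matrix.mulVec_sub,
      (Matrix.mem_rowStochastic.1 h.stochastic).2, Matrix.mulVec_single]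
    simp
  refine congrArg (1 / 2 * ·) (sum_congr rfl fun a _ => ?_)
  rw [Pi.abs_apply, happ, ← abs_of_nonneg (hμ a), ← abs_mul, abs_of_nonneg (hμ a), mul_sub,
    ← mul_assoc, h.balance a σ]
  field_simp

theorem IsReversible.tvDist_pow_le (h : IsReversible μ K) (hμ : ∀ a, 0 ≤ μ a)
    (hμ1 : ∑ a, μ a = 1) (hpos : ∀ f, 0 ≤ μ ⬝ᵥ (f * K *ᵥ f)) {γ : ℝ}
    (hγ : PoincareInequality μ K γ) (hσ : 0 < μ σ) (t : ℕ) :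
    tvDist ((K ^ t) σ) μ ≤ 1 / 2 * μ σ ^ (-(1 / 2) : ℝ) * Real.exp (-(t * γ)) := by
  set g := (K ^ t) *ᵥ centeredPointMass μ σ
  have hsq : (μ σ ^ (-(1 / 2) : ℝ) * Real.exp (-(t * γ))) ^ 2 =
      (Real.exp (-γ) ^ 2) ^ t * (μ σ)⁻¹ := by
    rw [mul_pow, ← Real.rpow_mul_natCast hσ.le, ← pow_mul, mul_comm 2 t, pow_mul,
      ← Real.exp_nat_mul (-γ) t, mul_neg]
    norm_num [Real.rpow_neg_one, mul_comm]
  have hg : (μ ⬝ᵥ |g|) ^ 2 ≤ (μ σ ^ (-(1 / 2) : ℝ) * Real.exp (-(t * γ))) ^ 2 := calc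
    (μ ⬝ᵥ |g|) ^ 2 ≤ μ ⬝ᵥ g ^ 2 := by
        have habs : |g| ^ 2 = g ^ 2 := funext fun a => sq_abs (g a)
        exact habs ▸ sq_dotProduct_le hμ hμ1 |g|
    _ ≤ (Real.exp (-γ) ^ 2) ^ t * (μ ⬝ᵥ centeredPointMass μ σ ^ 2) :=
        h.dotProduct_pow_mulVec_sq_le hμ hpos hγ (dotProduct_centeredPointMass hμ1 hσ.ne') t
    _ ≤ (Real.exp (-γ) ^ 2) ^ t * (μ σ)⁻¹ := by
        gcongr
        rw [dotProduct_centeredPointMass_sq hμ1 hσ.ne']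
        exact sub_le_self _ zero_le_one
    _ = _ := hsq.symm
  rw [(h.pow t).tvDist_eq hμ hσ.ne', mul_assoc]
  gcongr
  exact (le_abs_self _).trans (abs_le_of_sq_le_sq hg (by positivity))

end CenteredPointMass

end ReversibleChain

section Flip

variable {J : Type*} [DecidableEq J]

lemma flip_flip (x : J → Bool) (S T : Finset J) : flip (flip x S) T = flip x (symmDiff S T) := by
  funext i
  by_cases hS : i ∈ S <;> by_cases hT : i ∈ T <;> simp [flip, mem_symmDiff, hS, hT]

lemma flip_empty (x : J → Bool) : flip x ∅ = x := by
  funext i; simp [flip]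

lemma flip_flip_self (x : J → Bool) (S : Finset J) : flip (flip x S) S = x := by
  rw [flip_flip, symmDiff_self, bot_eq_empty, flip_empty]

lemma flip_injective (S : Finset J) : Function.Injective (fun x : J → Bool => flip x S) :=
  Function.LeftInverse.injective (g := fun x => flip x S) fun x => flip_flip_self x S

variable [Fintype J]

lemma diff_flip (x : J → Bool) (S : Finset J) : diff x (flip x S) = S := by
  ext i
  by_cases h : i ∈ S <;> simp [diff, flip, h]

lemma flip_diff (x y : J → Bool) : flip x (diff x y) = y := by
  funext i
  cases hx : x i <;> cases hy : y i <;> simp [diff, flip, hx, hy]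

/-- Flipping a fixed configuration identifies sets of positions with configurations. -/
def flipEquiv (x : J → Bool) : Finset J ≃ (J → Bool) where
  toFun := flip x
  invFun := diff x
  left_inv := diff_flip x
  right_inv := flip_diff x

lemma hammingDist_flip (x : J → Bool) (S : Finset J) : hammingDist x (flip x S) = S.card :=
  congrArg card (diff_flip x S)

end Flip

section SplitEdges

lemma card_symmDiff_add_two_mul_card_inter {α : Type*} [DecidableEq α] (A B : Finset α) :
    (symmDiff A B).card + 2 * (A ∩ B).card = A.card + B.card := by
  have hA := card_sdiff_add_card_inter A B
  have hB := card_sdiff_add_card_inter B A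
  rw [inter_comm B A] at hB
  rw [symmDiff_def, sup_eq_union, card_union_of_disjoint disjoint_sdiff_sdiff]
  omega

lemma even_card_symmDiff_iff {α : Type*} [DecidableEq α] (A B : Finset α) :
    Even (symmDiff A B).card ↔ (Even A.card ↔ Even B.card) := by
  have := card_symmDiff_add_two_mul_card_inter A B
  grind

variable {E : Type*} [Fintype E] [DecidableEq E]

/-- The edges with exactly one half-edge in `T`: those on which flipping `T` changes whether the
two half-edges agree. -/
def splitEdges (T : Finset (E × Bool)) : Finset E :=
  {e | ¬((e, false) ∈ T ↔ (e, true) ∈ T)}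

lemma mem_splitEdges {T : Finset (E × Bool)} {e : E} :
    e ∈ splitEdges T ↔ ¬((e, false) ∈ T ↔ (e, true) ∈ T) := by
  simp [splitEdges]

lemma splitEdges_empty : splitEdges (∅ : Finset (E × Bool)) = ∅ := by
  simp [splitEdges]

lemma splitEdges_symmDiff (S T : Finset (E × Bool)) :
    splitEdges (symmDiff S T) = symmDiff (splitEdges S) (splitEdges T) := by
  ext e
  simp only [mem_splitEdges, mem_symmDiff]
  tauto

lemma exists_mem_of_mem_splitEdges {T : Finset (E × Bool)} {e : E} (he : e ∈ splitEdges T) :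
    ∃ h ∈ T, h.1 = e := by
  rw [mem_splitEdges] at he
  by_cases hT : (e, false) ∈ T
  · exact ⟨(e, false), hT, rfl⟩
  · exact ⟨(e, true), by tauto, rfl⟩

lemma mem_splitEdges_of_subset {T U : Finset (E × Bool)} (hTU : T ⊆ U) {h : E × Bool} (hT : h ∈ T)
    (hU : h.1 ∈ splitEdges U) : h.1 ∈ splitEdges T := by
  obtain ⟨e, b⟩ := h
  rw [mem_splitEdges] at hU ⊢
  cases b <;> grind

lemma card_splitEdges_le (T : Finset (E × Bool)) : (splitEdges T).card ≤ T.card :=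
  (card_le_card fun _ he => mem_image.2 (exists_mem_of_mem_splitEdges he)).trans
    (card_image_le (f := Prod.fst))

lemma even_card_splitEdges (T : Finset (E × Bool)) : Even (splitEdges T).card ↔ Even T.card := by
  induction T using Finset.induction_on with
  | empty => simp [splitEdges_empty]
  | insert h T hT ih =>
    have hinsert : insert h T = symmDiff {h} T := by
      rw [insert_eq, symmDiff_eq_union (disjoint_singleton_left.2 hT)]
    have hsingle : splitEdges {h} = {h.1} := by
      ext e
      obtain ⟨e', b⟩ := h
      cases b <;> simp [mem_splitEdges]
    rw [hinsert, splitEdges_symmDiff, even_card_symmDiff_iff, even_card_symmDiff_iff, ih, hsingle,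
      card_singleton, card_singleton]

lemma card_splitEdges_symmDiff_le (S T : Finset (E × Bool)) :
    (splitEdges (symmDiff S T)).card ≤ (splitEdges S).card + (splitEdges T).card := by
  rw [splitEdges_symmDiff]
  have := card_symmDiff_add_two_mul_card_inter (splitEdges S) (splitEdges T)
  omega

lemma card_splitEdges_symmDiff_pair_le {T S : Finset (E × Bool)} (hS : S.card = 2)
    {h : E × Bool} (hh : h ∈ S) (hT : h.1 ∈ splitEdges T) :
    (splitEdges (symmDiff T S)).card ≤ (splitEdges T).card := by
  have hcard := card_symmDiff_add_two_mul_card_inter (splitEdges T) (splitEdges S)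
  rw [← splitEdges_symmDiff] at hcard
  by_cases hsplit : h.1 ∈ splitEdges S
  · have hinter := card_pos.2 ⟨h.1, mem_inter.2 ⟨hT, hsplit⟩⟩
    have hle := card_splitEdges_le S
    omega
  · have hSe : {(h.1, false), (h.1, true)} = S := by
      refine eq_of_subset_of_card_le (fun i hi => ?_) (by rw [hS, card_pair (by simp)])
      obtain ⟨e, b⟩ := h
      rw [mem_splitEdges, not_not] at hsplit
      cases b <;> grind
    have hempty : splitEdges S = ∅ := by
      ext e; simp [← hSe, mem_splitEdges]
    rw [hempty, card_empty] at hcard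
    omega

end SplitEdges

section Layers

variable {E : Type*} [Fintype E] [DecidableEq E]

variable (E) in
/-- The set `Ω_k` of the configurations with `k` disagreeing edges. -/
def layer (k : ℕ) : Finset (Config E) := {σ | disagreements σ = k}

variable (E) in
/-- The state space `Ω = Ω₀ ∪ Ω₂` as a set of configurations; `State E` is the
corresponding type. -/
def states : Finset (Config E) := layer E 0 ∪ layer E 2

lemma mem_layer {σ : Config E} {k : ℕ} : σ ∈ layer E k ↔ disagreements σ = k := by
  simp [layer]

lemma disjoint_layer {k l : ℕ} (h : k ≠ l) : Disjoint (layer E k) (layer E l) :=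
  disjoint_left.2 fun _ hk hl => h ((mem_layer.1 hk).symm.trans (mem_layer.1 hl))

lemma mem_states {σ : Config E} :
    σ ∈ states E ↔ disagreements σ = 0 ∨ disagreements σ = 2 := by
  simp [states, mem_layer]

variable {σ : Config E} (hσ : σ ∈ layer E 0)

include hσ

lemma disagreements_flip (T : Finset (E × Bool)) :
    disagreements (flip σ T) = (splitEdges T).card := by
  rw [mem_layer, disagreements, card_eq_zero, filter_eq_empty_iff] at hσ
  refine congrArg card (filter_congr fun e _ => ?_)
  have hagree := not_not.1 (hσ (mem_univ e))
  by_cases hfalse : (e, false) ∈ T <;> by_cases htrue : (e, true) ∈ T <;>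
    simp [flip, hagree, hfalse, htrue]

lemma flip_mem_layer_iff (T : Finset (E × Bool)) (k : ℕ) :
    flip σ T ∈ layer E k ↔ (splitEdges T).card = k := by
  rw [mem_layer, disagreements_flip hσ]

lemma flip_mem_states_iff {T : Finset (E × Bool)} (hT : Even T.card) :
    flip σ T ∈ states E ↔ (splitEdges T).card ≤ 2 := by
  have := (even_card_splitEdges T).2 hT
  rw [mem_states, disagreements_flip hσ]
  grind

lemma flip_mem_states_union_layer_iff {T : Finset (E × Bool)} (hT : Even T.card) :
    flip σ T ∈ states E ∪ layer E 4 ↔ (splitEdges T).card ≤ 4 := by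
  have := (even_card_splitEdges T).2 hT
  rw [mem_union, mem_states, mem_layer, disagreements_flip hσ]
  grind

end Layers

section Matching

variable {J : Type*}

/-- `M` consists of pairwise disjoint pairs. The set `A` that it partitions, which is an argument of
`IsPairing`, is recovered as `support M`. -/
structure IsMatching (M : Finset (Finset J)) : Prop where
  pairwiseDisjoint : (M : Set (Finset J)).PairwiseDisjoint id
  card_eq_two : ∀ S ∈ M, S.card = 2

lemma IsMatching.subset {M N : Finset (Finset J)} (hM : IsMatching M) (h : N ⊆ M) :
    IsMatching N :=
  ⟨hM.1.subset (coe_subset.2 h), fun S hS => hM.2 S (h hS)⟩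

variable (J) in
open Classical in
/-- The set of all matchings on `J`, over which windings are summed. -/
noncomputable def matchings [Fintype J] : Finset (Finset (Finset J)) := {M | IsMatching M}

lemma mem_matchings [Fintype J] {M : Finset (Finset J)} : M ∈ matchings J ↔ IsMatching M := by
  simp [matchings]

lemma eq_of_mem_of_mem {P : Finset (Finset J)} (hP : (P : Set (Finset J)).PairwiseDisjoint id)
    {S T : Finset J} (hS : S ∈ P) (hT : T ∈ P) {h : J} (hhS : h ∈ S) (hhT : h ∈ T) : S = T :=
  hP.elim hS hT (not_disjoint_iff.2 ⟨h, hhS, hhT⟩)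

variable [DecidableEq J]

/-- The union of the blocks of `M`: the set of positions at which two configurations joined by `M`
differ. -/
def support (M : Finset (Finset J)) : Finset J := M.biUnion id

lemma mem_support {M : Finset (Finset J)} {h : J} : h ∈ support M ↔ ∃ S ∈ M, h ∈ S := by
  simp [support]

lemma subset_support {M : Finset (Finset J)} {S : Finset J} (hS : S ∈ M) : S ⊆ support M :=
  subset_biUnion_of_mem id hS

lemma support_mono {M N : Finset (Finset J)} (h : N ⊆ M) : support N ⊆ support M :=
  biUnion_subset_biUnion_of_subset_left id h

lemma support_empty : support (∅ : Finset (Finset J)) = ∅ := biUnion_empty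

lemma support_singleton (S : Finset J) : support {S} = S := singleton_biUnion

lemma support_union (M N : Finset (Finset J)) : support (M ∪ N) = support M ∪ support N :=
  union_biUnion

section PairwiseDisjoint

variable {P N : Finset (Finset J)} (hP : (P : Set (Finset J)).PairwiseDisjoint id)

include hP

lemma disjoint_support_sdiff (hN : N ⊆ P) : Disjoint (support N) (support (P \ N)) := by
  rw [disjoint_left]
  intro h hhN hhP
  obtain ⟨S, hS, hhS⟩ := mem_support.1 hhN
  obtain ⟨T, hT, hhT⟩ := mem_support.1 hhP
  obtain rfl := eq_of_mem_of_mem hP (hN hS) (mem_sdiff.1 hT).1 hhS hhT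
  exact (mem_sdiff.1 hT).2 hS

lemma support_sdiff (hN : N ⊆ P) : support (P \ N) = symmDiff (support P) (support N) := by
  have hunion : support P = symmDiff (support N) (support (P \ N)) := by
    rw [symmDiff_eq_union (disjoint_support_sdiff hP hN), ← support_union, union_sdiff_of_subset hN]
  rw [hunion, symmDiff_comm (support N), symmDiff_symmDiff_cancel_right]

lemma support_erase {S : Finset J} (hS : S ∈ P) :
    support (P.erase S) = symmDiff (support P) S := by
  rw [← sdiff_singleton_eq_erase, support_sdiff hP (singleton_subset_iff.2 hS), support_singleton]

lemma support_insert (hN : N ⊆ P) {S : Finset J} (hS : S ∈ P) (hSN : S ∉ N) :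
    support (insert S N) = symmDiff (support N) S := by
  have := support_erase (hP.subset (coe_subset.2 (insert_subset hS hN))) (mem_insert_self S N)
  rw [erase_insert hSN] at this
  rw [this, symmDiff_symmDiff_cancel_right]

end PairwiseDisjoint

namespace IsMatching

variable {M : Finset (Finset J)} (hM : IsMatching M)

include hM

lemma card_support : (support M).card = M.card * 2 :=
  (card_biUnion fun _ hS _ hT h => hM.1 hS hT h).trans (sum_const_nat hM.2)

lemma even_card_support : Even (support M).card := by
  simp [hM.card_support]

lemma union {N : Finset (Finset J)} (hN : IsMatching N) (h : Disjoint (support M) (support N)) :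
    IsMatching (M ∪ N) := by
  refine ⟨?_, fun S hS => (mem_union.1 hS).elim (hM.2 S) (hN.2 S)⟩
  rw [coe_union, Set.pairwiseDisjoint_union]
  exact ⟨hM.1, hN.1, fun S hS T hT _ => h.mono (subset_support hS) (subset_support hT)⟩

end IsMatching

lemma exists_isMatching_of_even (A : Finset J) (hA : Even A.card) :
    ∃ M, IsMatching M ∧ support M = A := by
  obtain ⟨m, hm⟩ := hA.exists_two_nsmul
  induction m generalizing A with
  | zero => exact ⟨∅, ⟨by simp, by simp⟩, by rw [support_empty, card_eq_zero.1 hm]⟩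
  | succ m ih =>
    obtain ⟨T, hTA, hT⟩ := exists_subset_card_eq (s := A) (n := 2) (by simp at hm; omega)
    have hcard := card_sdiff_of_subset hTA
    obtain ⟨M, hM, hMA⟩ := ih (A \ T) (by rw [hcard, hm, hT]; exact ⟨m, by grind⟩)
      (by rw [hcard, hm, hT]; simp; omega)
    have hpair : IsMatching {T} := ⟨by simp, by simp [hT]⟩
    have hdisj : Disjoint (support {T}) (support M) := by
      rw [support_singleton, hMA]; exact disjoint_sdiff
    refine ⟨{T} ∪ M, hpair.union hM hdisj, ?_⟩
    rw [support_union, support_singleton, hMA, union_sdiff_of_subset hTA]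

end Matching

section WindingOrder

variable {E : Type*} [Fintype E] [DecidableEq E]

lemma IsMatching.even_card_splitEdges {M : Finset (Finset (E × Bool))} (hM : IsMatching M) :
    Even (splitEdges (support M)).card :=
  (Holant.even_card_splitEdges _).2 hM.even_card_support

lemma IsMatching.exists_card_splitEdges_erase_le {M : Finset (Finset (E × Bool))}
    (hM : IsMatching M) (hne : M.Nonempty) (hle : (splitEdges (support M)).card ≤ 2) :
    ∃ S ∈ M, (splitEdges (support (M.erase S))).card ≤ 2 := by
  rcases (splitEdges (support M)).eq_empty_or_nonempty with hempty | ⟨e, he⟩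
  · obtain ⟨S, hS⟩ := hne
    refine ⟨S, hS, ?_⟩
    rw [support_erase hM.1 hS]
    have hsymm := card_splitEdges_symmDiff_le (support M) S
    rw [hempty, card_empty, zero_add] at hsymm
    exact hsymm.trans ((card_splitEdges_le S).trans (hM.2 S hS).le)
  · obtain ⟨h, hh, rfl⟩ := exists_mem_of_mem_splitEdges he
    obtain ⟨S, hS, hhS⟩ := mem_support.1 hh
    refine ⟨S, hS, ?_⟩
    rw [support_erase hM.1 hS]
    exact (card_splitEdges_symmDiff_pair_le (hM.2 S hS) hhS he).trans hle

/-- The blocks of `M` are flipped one after the other, `pre S` being the set of the blocks flipped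
before `S`. The order itself is encoded by telescoping: the steps `pre S → insert S (pre S)` lead
from `∅` to `M`. -/
structure IsWindingOrder {J : Type*} [DecidableEq J] (M : Finset (Finset J))
    (pre : Finset J → Finset (Finset J)) : Prop where
  subset_erase : ∀ S ∈ M, pre S ⊆ M.erase S
  telescope : ∀ g : Finset (Finset J) → ℝ,
    ∑ S ∈ M, (g (insert S (pre S)) - g (pre S)) = g M - g ∅

lemma IsWindingOrder.of_erase {J : Type*} [DecidableEq J] {M : Finset (Finset J)} {S : Finset J}
    (hS : S ∈ M) {pre : Finset J → Finset (Finset J)} (h : IsWindingOrder (M.erase S) pre) :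
    IsWindingOrder M (Function.update pre S (M.erase S)) := by
  refine ⟨fun T hT => ?_, fun g => ?_⟩
  · rcases eq_or_ne T S with rfl | hTS
    · rw [Function.update_self]
    · rw [Function.update_of_ne hTS]
      exact (h.subset_erase T (mem_erase.2 ⟨hTS, hT⟩)).trans
        (erase_subset_erase _ (erase_subset _ _))
  · rw [← add_sum_erase _ _ hS, sum_congr rfl fun T hT => by
      rw [Function.update_of_ne (ne_of_mem_erase hT)], h.telescope, Function.update_self,
      insert_erase hS]
    ring

lemma IsMatching.exists_isWindingOrder {M : Finset (Finset (E × Bool))} (hM : IsMatching M)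
    (hle : (splitEdges (support M)).card ≤ 2) :
    ∃ pre, IsWindingOrder M pre ∧ ∀ S ∈ M, (splitEdges (support (pre S))).card ≤ 2 ∧
      (splitEdges (support (insert S (pre S)))).card ≤ 2 := by
  induction hn : M.card generalizing M with
  | zero =>
    obtain rfl := card_eq_zero.1 hn
    exact ⟨fun _ => ∅, ⟨by simp, by simp⟩, by simp⟩
  | succ n ih =>
    obtain ⟨S, hS, hSle⟩ := hM.exists_card_splitEdges_erase_le (card_pos.1 (by omega)) hle
    obtain ⟨pre, hpre, hprele⟩ := ih (hM.subset (erase_subset S M)) hSle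
      (by rw [card_erase_of_mem hS, hn, Nat.add_sub_cancel])
    refine ⟨_, hpre.of_erase hS, fun T hT => ?_⟩
    rcases eq_or_ne T S with rfl | hTS
    · rw [Function.update_self, insert_erase hS]
      exact ⟨hSle, hle⟩
    · rw [Function.update_of_ne hTS]
      exact hprele T (mem_erase.2 ⟨hTS, hT⟩)

lemma IsMatching.exists_subset_splitEdges {M : Finset (Finset (E × Bool))} (hM : IsMatching M)
    (hne : (splitEdges (support M)).Nonempty) :
    ∃ K ⊆ M, (splitEdges (support K)).card = 2 ∧
      splitEdges (support K) ⊆ splitEdges (support M) := by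
  obtain ⟨_, he⟩ := hne
  obtain ⟨h, hh, rfl⟩ := exists_mem_of_mem_splitEdges he
  obtain ⟨S, hS, hhS⟩ := mem_support.1 hh
  let candidates := {N ∈ M.powerset | h ∈ support N ∧ (splitEdges (support N)).card ≤ 2}
  have hcand : candidates.Nonempty := by
    refine ⟨{S}, mem_filter.2 ⟨mem_powerset.2 (singleton_subset_iff.2 hS), ?_⟩⟩
    rw [support_singleton]
    exact ⟨hhS, (card_splitEdges_le S).trans (hM.2 S hS).le⟩
  obtain ⟨K, hK, hmax⟩ := exists_max_image candidates card hcand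
  obtain ⟨hKM, hhK, hK2⟩ : K ⊆ M ∧ h ∈ support K ∧ (splitEdges (support K)).card ≤ 2 := by
    simpa [candidates] using hK
  refine ⟨K, hKM, ?_, fun e' he' => ?_⟩
  · have hpos := card_pos.2 ⟨_, mem_splitEdges_of_subset (support_mono hKM) hhK he⟩
    have heven := (hM.subset hKM).even_card_splitEdges
    grind
  · -- A block outside `K` through a split edge of `K` could be added to `K`.
    by_contra hMe'
    have hsdiff : e' ∈ splitEdges (support (M \ K)) := by
      rw [support_sdiff hM.1 hKM, splitEdges_symmDiff, mem_symmDiff]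
      exact Or.inr ⟨he', hMe'⟩
    obtain ⟨h', hh', rfl⟩ := exists_mem_of_mem_splitEdges hsdiff
    obtain ⟨T, hT, hhT⟩ := mem_support.1 hh'
    obtain ⟨hTM, hTK⟩ := mem_sdiff.1 hT
    have hins : insert T K ∈ candidates := by
      refine mem_filter.2 ⟨mem_powerset.2 (insert_subset hTM hKM),
        support_mono (subset_insert T K) hhK, ?_⟩
      rw [support_insert hM.1 hKM hTM hTK]
      exact (card_splitEdges_symmDiff_pair_le (hM.2 T hTM) hhT he').trans hK2
    have := hmax _ hins
    rw [card_insert_of_notMem hTK] at this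
    omega

lemma IsMatching.exists_subset_card_splitEdges {M : Finset (Finset (E × Bool))}
    (hM : IsMatching M) (hcard : (splitEdges (support M)).card = 4) :
    ∃ K ⊆ M, (splitEdges (support K)).card = 2 ∧ (splitEdges (support (M \ K))).card = 2 := by
  obtain ⟨K, hKM, hK, hsub⟩ := hM.exists_subset_splitEdges (card_pos.1 (by omega))
  refine ⟨K, hKM, hK, ?_⟩
  rw [support_sdiff hM.1 hKM, splitEdges_symmDiff, symmDiff_of_ge hsub, card_sdiff_of_subset hsub,
    hcard, hK]

end WindingOrder

section Coarsening

variable {J : Type*} [DecidableEq J]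

lemma mem_pairings [Fintype J] {A : Finset J} {M : Finset (Finset J)} :
    M ∈ pairings A ↔ IsPairing A M := by
  simp [pairings]

lemma exists_isMatching_coarsening {P : Finset (Finset J)}
    (hP : (P : Set (Finset J)).PairwiseDisjoint id) (hcard : ∀ S ∈ P, S.card = 1 ∨ S.card = 2)
    (heven : Even (support P).card) :
    ∃ M, IsMatching M ∧ support M = support P ∧
      ∀ S ∈ M, S ∈ P ∨ ∃ i j, i ≠ j ∧ {i} ∈ P ∧ {j} ∈ P ∧ S = {i, j} := by
  let pairs := {S ∈ P | S.card = 2}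
  have hsub : pairs ⊆ P := filter_subset _ _
  have hpairs : IsMatching pairs :=
    ⟨hP.subset (coe_subset.2 hsub), fun S hS => (mem_filter.1 hS).2⟩
  have hunion : support pairs ∪ support (P \ pairs) = support P := by
    rw [← support_union, union_sdiff_of_subset hsub]
  have hdisj : Disjoint (support pairs) (support (P \ pairs)) := disjoint_support_sdiff hP hsub
  have hsingle : ∀ i ∈ support (P \ pairs), {i} ∈ P := by
    intro i hi
    obtain ⟨S, hS, hiS⟩ := mem_support.1 hi
    obtain ⟨hSP, hSpairs⟩ := mem_sdiff.1 hS
    obtain ⟨j, rfl⟩ := card_eq_one.1 <|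
      (hcard S hSP).resolve_right fun h => hSpairs (mem_filter.2 ⟨hSP, h⟩)
    rwa [mem_singleton.1 hiS]
  rw [← hunion, card_union_of_disjoint hdisj, Nat.even_add] at heven
  obtain ⟨N, hN, hNsupp⟩ :=
    exists_isMatching_of_even (support (P \ pairs)) (heven.1 hpairs.even_card_support)
  refine ⟨pairs ∪ N, hpairs.union hN (hNsupp ▸ hdisj), by rw [support_union, hNsupp, hunion],
    fun S hS => (mem_union.1 hS).imp (fun h => hsub h) fun hSN => ?_⟩
  obtain ⟨i, j, hij, rfl⟩ := card_eq_two.1 (hN.2 S hSN)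
  have hmem : {i, j} ⊆ support (P \ pairs) := hNsupp ▸ subset_support hSN
  exact ⟨i, j, hij, hsingle i (hmem (by simp)), hsingle j (hmem (by simp)), rfl⟩

end Coarsening

section FiberPart

variable {J V : Type*} [DecidableEq V] {p : J → V}

variable (p) in
/-- The part of `S` in the fiber of `p` over `v`, as a subset of that fiber. -/
def fiberPart (v : V) (S : Finset J) : Finset {h : J // p h = v} := S.subtype fun h => p h = v

lemma mem_fiberPart {v : V} {S : Finset J} {h : {h : J // p h = v}} :
    h ∈ fiberPart p v S ↔ h.1 ∈ S := by
  simp [fiberPart]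

lemma fiberPart_map {v : V} (B : Finset {h : J // p h = v}) :
    fiberPart p v (B.map (.subtype _)) = B := by
  ext h
  rw [mem_fiberPart]
  exact mem_map' (Function.Embedding.subtype _)

lemma fiberPart_eq_empty {v : V} {S : Finset J} (h : ∀ i ∈ S, p i ≠ v) : fiberPart p v S = ∅ :=
  eq_empty_of_forall_notMem fun i hi => h i.1 (mem_fiberPart.1 hi) i.2

lemma fiberPart_singleton {v : V} (h : {h : J // p h = v}) : fiberPart p v {h.1} = {h} := by
  ext i
  simp [mem_fiberPart, Subtype.ext_iff]

variable [DecidableEq J]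

lemma fiberPart_union (v : V) (S T : Finset J) :
    fiberPart p v (S ∪ T) = fiberPart p v S ∪ fiberPart p v T := by
  ext h; simp [mem_fiberPart]

lemma flip_fiberPart (x : J → Bool) (S : Finset J) (v : V) :
    flip (fun h : {h : J // p h = v} => x h.1) (fiberPart p v S) = fun h => flip x S h.1 := by
  funext h
  simp [flip, mem_fiberPart]

end FiberPart

section LiftBlocks

variable {J V : Type*} [DecidableEq J] [Fintype V] {p : J → V}

/-- The blocks of all the families `k v`, which live on the fibers of `p`, as subsets of the total
space. -/
def liftBlocks (k : (v : V) → Finset (Finset {h : J // p h = v})) : Finset (Finset J) :=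
  univ.biUnion fun v => (k v).image (Finset.map (.subtype _))

variable {k : (v : V) → Finset (Finset {h : J // p h = v})}

lemma mem_liftBlocks {S : Finset J} :
    S ∈ liftBlocks k ↔ ∃ v, ∃ B ∈ k v, B.map (.subtype _) = S := by
  simp [liftBlocks]

lemma pairwiseDisjoint_liftBlocks
    (hk : ∀ v, (k v : Set (Finset {h : J // p h = v})).PairwiseDisjoint id) :
    (liftBlocks k : Set (Finset J)).PairwiseDisjoint id := by
  intro S hS T hT hne
  obtain ⟨v, B, hB, rfl⟩ := mem_liftBlocks.1 hS
  obtain ⟨u, C, hC, rfl⟩ := mem_liftBlocks.1 hT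
  rcases eq_or_ne u v with rfl | huv
  · exact (disjoint_map _).2 (hk u hB hC fun h => hne (by rw [h]))
  · refine disjoint_left.2 fun i hi hi' => huv ?_
    obtain ⟨h, -, rfl⟩ := mem_map.1 hi
    obtain ⟨h', -, heq⟩ := mem_map.1 hi'
    exact h'.2.symm.trans ((congrArg p heq).trans h.2)

variable [DecidableEq V]

lemma fiberPart_liftBlocks {S : Finset J} (hS : S ∈ liftBlocks k) (v : V) :
    fiberPart p v S = ∅ ∨ fiberPart p v S ∈ k v := by
  obtain ⟨u, B, hB, rfl⟩ := mem_liftBlocks.1 hS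
  rcases eq_or_ne u v with rfl | huv
  · right; rwa [fiberPart_map]
  · left
    refine fiberPart_eq_empty fun i hi => ?_
    obtain ⟨h, -, rfl⟩ := mem_map.1 hi
    exact h.2.trans_ne huv

lemma support_liftBlocks {D : Finset J} (hk : ∀ v, (k v).biUnion id = fiberPart p v D) :
    support (liftBlocks k) = D := by
  ext i
  have hi := Finset.ext_iff.1 (hk (p i)) ⟨i, rfl⟩
  rw [mem_fiberPart] at hi
  rw [← hi]
  simp only [mem_support, mem_liftBlocks, mem_biUnion, id]
  constructor
  · rintro ⟨_, ⟨v, B, hB, rfl⟩, hiB⟩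
    obtain ⟨h, hhB, rfl⟩ := mem_map.1 hiB
    obtain ⟨h, rfl⟩ := h
    exact ⟨B, hB, hhB⟩
  · rintro ⟨B, hB, hiB⟩
    exact ⟨_, ⟨p i, B, hB, rfl⟩, mem_map_of_mem _ hiB⟩

omit [DecidableEq V] in
lemma ne_of_singleton_mem_liftBlocks (hk : ∀ v, {B ∈ k v | B.card = 1}.card ≤ 1) {i j : J}
    (hij : i ≠ j) (hi : {i} ∈ liftBlocks k) (hj : {j} ∈ liftBlocks k) : p i ≠ p j := by
  classical
  intro hp
  have hmem : ∀ h : {h : J // p h = p j}, {h.1} ∈ liftBlocks k →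
      {h} ∈ {B ∈ k (p j) | B.card = 1} := fun h hh => by
    have := fiberPart_liftBlocks hh (p j)
    rw [fiberPart_singleton] at this
    exact mem_filter.2 ⟨this.resolve_left (singleton_ne_empty h), card_singleton h⟩
  have := card_le_one.1 (hk (p j)) _ (hmem ⟨i, hp⟩ hi) _ (hmem ⟨j, rfl⟩ hj)
  exact hij (congrArg Subtype.val (singleton_injective this))

omit [Fintype V] in
-- A fiber contains at most one singleton, so two paired singletons come from different fibers.
lemma exists_isMatching_of_isPairing [Finite V] {D : Finset J} (hD : Even D.card)
    (hk : ∀ v, IsPairing (fiberPart p v D) (k v)) :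
    ∃ M, IsMatching M ∧ support M = D ∧
      ∀ S ∈ M, ∀ v, fiberPart p v S = ∅ ∨ fiberPart p v S ∈ k v := by
  cases nonempty_fintype V
  have hsupp : support (liftBlocks k) = D := support_liftBlocks fun v => (hk v).2.1
  have hcard : ∀ S ∈ liftBlocks k, S.card = 1 ∨ S.card = 2 := by
    intro S hS
    obtain ⟨v, B, hB, rfl⟩ := mem_liftBlocks.1 hS
    rw [card_map]
    exact (hk v).2.2.1 B hB
  obtain ⟨M, hM, hMD, hblock⟩ := exists_isMatching_coarsening
    (pairwiseDisjoint_liftBlocks fun v => (hk v).1) hcard (hsupp ▸ hD)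
  refine ⟨M, hM, hMD.trans hsupp, fun S hS v => ?_⟩
  obtain hS | ⟨i, j, hij, hi, hj, rfl⟩ := hblock S hS
  · exact fiberPart_liftBlocks hS v
  have hp : p i ≠ p j := ne_of_singleton_mem_liftBlocks (fun v => (hk v).2.2.2) hij hi hj
  have hne : ∀ a, p a ≠ v → fiberPart p v {a} = ∅ := fun a ha =>
    fiberPart_eq_empty fun b hb => by rwa [mem_singleton.1 hb]
  rw [insert_eq, fiberPart_union]
  rcases eq_or_ne (p i) v with rfl | hiv
  · rw [hne j hp.symm, union_empty]
    exact fiberPart_liftBlocks hi _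
  · rw [hne i hiv, empty_union]
    exact fiberPart_liftBlocks hj _

end LiftBlocks

section Winding

variable {J : Type*} [Fintype J] [DecidableEq J]

/-- `b` splits the products of two values of `w`, on configurations that differ in an even number
of positions, over the matchings of the difference, invariantly under flips of blocks. In contrast
to `Windable`, the second configuration is recovered from the first one and the matching. -/
structure IsWinding (w : (J → Bool) → ℝ) (b : (J → Bool) → Finset (Finset J) → ℝ) : Prop where
  nonneg : ∀ x M, 0 ≤ b x M
  mul_eq_sum : ∀ x D, Even D.card →
    w x * w (flip x D) = ∑ M ∈ matchings J with support M = D, b x M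
  flip_block : ∀ x M, IsMatching M → ∀ S ∈ M, b (flip x S) M = b x M

lemma Windable.exists_eq_sum_pairings {F : (J → Bool) → ℝ} (hF : Windable F) :
    ∃ c : (J → Bool) → Finset (Finset J) → ℝ,
      (∀ x D, F x * F (flip x D) = ∑ k ∈ pairings D, c x k) ∧
      (∀ x D, ∀ k ∈ pairings D, 0 ≤ c x k) ∧
      ∀ x D, ∀ k ∈ pairings D, ∀ S ∈ k, c (flip x S) k = c x k := by
  obtain ⟨B, hnonneg, hsum, hflip⟩ := hF
  have hB : ∀ (x : J → Bool) (D : Finset J), ∀ k ∈ pairings D, flip x (support k) = flip x D ∧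
      k ∈ pairings (diff x (flip x (support k))) := fun x D k hk => by
    rw [diff_flip, support, (mem_pairings.1 hk).2.1]
    exact ⟨rfl, hk⟩
  refine ⟨fun x k => B x (flip x (support k)) k, fun x D => ?_,
    fun x D k hk => hnonneg _ _ _ (hB x D k hk).2, fun x D k hk S hS => ?_⟩
  · rw [hsum, diff_flip]
    exact sum_congr rfl fun k hk => congrArg (B x · k) (hB x D k hk).1.symm
  · beta_reduce
    rw [hflip x _ k (hB x D k hk).2 S hS, flip_flip, flip_flip, symmDiff_comm]

lemma exists_isWinding {V : Type*} [Fintype V] [DecidableEq V] (p : J → V)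
    {f : (v : V) → ({h : J // p h = v} → Bool) → ℝ} (hf : ∀ v, Windable (f v)) :
    ∃ b, IsWinding (fun x : J → Bool => ∏ v, f v fun h => x h.1) b := by
  classical
  choose c hsum hnonneg hflip using fun v => (hf v).exists_eq_sum_pairings
  have hcoarsen : ∀ (D : Finset J) (k : (v : V) → Finset (Finset {h : J // p h = v})),
      Even D.card → (∀ v, k v ∈ pairings (fiberPart p v D)) → ∃ M, IsMatching M ∧ support M = D ∧
        ∀ S ∈ M, ∀ v, fiberPart p v S = ∅ ∨ fiberPart p v S ∈ k v :=
    fun D k hD hk => exists_isMatching_of_isPairing hD fun v => mem_pairings.1 (hk v)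
  choose! coarse hmatch hsupp hblock using hcoarsen
  refine ⟨fun x M => ∑ k ∈ Fintype.piFinset fun v => pairings (fiberPart p v (support M)) with
    coarse (support M) k = M, ∏ v, c v (fun h => x h.1) (k v), fun x M => ?_, fun x D hD => ?_,
    fun x M hM S hS => sum_congr rfl fun k hk => prod_congr rfl fun v _ => ?_⟩
  · exact sum_nonneg fun k hk => prod_nonneg fun v _ =>
      hnonneg v _ _ _ (Fintype.mem_piFinset.1 (mem_filter.1 hk).1 v)
  · have hmaps : ∀ k ∈ Fintype.piFinset fun v => pairings (fiberPart p v D),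
        coarse D k ∈ {M ∈ matchings J | support M = D} := fun k hk =>
      have hk := Fintype.mem_piFinset.1 hk
      mem_filter.2 ⟨mem_matchings.2 (hmatch D k hD hk), hsupp D k hD hk⟩
    calc (∏ v, f v fun h => x h.1) * (∏ v, f v fun h => flip x D h.1)
        = ∏ v, ∑ k ∈ pairings (fiberPart p v D), c v (fun h => x h.1) k := by
          simp only [← prod_mul_distrib, ← hsum, flip_fiberPart]
      _ = _ := by
          rw [prod_univ_sum, ← sum_fiberwise_of_maps_to hmaps]
          exact sum_congr rfl fun M hM => by rw [(mem_filter.1 hM).2]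
  · obtain ⟨hk, hkM⟩ := mem_filter.1 hk
    have hk := Fintype.mem_piFinset.1 hk
    rw [← flip_fiberPart]
    rcases hblock _ k hM.even_card_support hk S (hkM.symm ▸ hS) v with hempty | hmem
    · rw [hempty, flip_empty]
    · exact hflip v _ _ _ (hk v) _ hmem

end Winding

section Flow

variable {J : Type*} [Fintype J] [DecidableEq J]

/-- The configurations `a` in `A` at which the canonical paths inside `A` along the matching `M` may
flip the block `S`. Complementing by `M` must lead from both ends of the move to `R`, as the
congestion of the move is estimated by the total weight of `R`. -/
def windingMoves (A R : Finset (J → Bool)) (M : Finset (Finset J)) (S : Finset J) :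
    Finset (J → Bool) :=
  {a ∈ A | flip a S ∈ A ∧ flip a (support M) ∈ R ∧ flip (flip a S) (support M) ∈ R}

/-- The energy of `F` along the moves inside `A` that flip two positions, where the move between
`a` and `c` has conductance `min (w a) (w c)`. For `A = states E` it is a multiple of the Dirichlet
form of the Metropolis chain. -/
noncomputable def moveEnergy (w : (J → Bool) → ℝ) (A : Finset (J → Bool)) (F : (J → Bool) → ℝ) :
    ℝ :=
  ∑ a ∈ A, ∑ c ∈ A with hammingDist a c = 2, min (w a) (w c) * (F c - F a) ^ 2

omit [DecidableEq J] in
lemma moveEnergy_nonneg {w : (J → Bool) → ℝ} (hw : ∀ x, 0 ≤ w x) (A : Finset (J → Bool))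
    (F : (J → Bool) → ℝ) : 0 ≤ moveEnergy w A F :=
  sum_nonneg fun _ _ => sum_nonneg fun _ _ => mul_nonneg (le_min (hw _) (hw _)) (sq_nonneg _)

omit [Fintype J] in
lemma sum_flip_le {s t : Finset (J → Bool)} {g : (J → Bool) → ℝ} {T : Finset J}
    (hst : ∀ x ∈ s, flip x T ∈ t) (hg : ∀ x, 0 ≤ g x) : ∑ x ∈ s, g (flip x T) ≤ ∑ x ∈ t, g x := by
  classical
  rw [← sum_image (g := fun x => flip x T) (flip_injective T).injOn]
  exact sum_le_sum_of_subset_of_nonneg (image_subset_iff.2 hst) fun x _ _ => hg x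

lemma sum_mul_sum_mul_sq_le {ι : Type*} {w : ι → ℝ} (hw : ∀ i, 0 ≤ w i) (s t : Finset ι)
    {F : ι → ℝ} (hF : ∑ j ∈ t, w j * F j = 0) :
    (∑ i ∈ s, w i) * ∑ j ∈ t, w j * F j ^ 2 ≤
      ∑ i ∈ s, ∑ j ∈ t, w i * w j * (F j - F i) ^ 2 := by
  rw [sum_mul]
  refine sum_le_sum fun i _ => ?_
  calc w i * ∑ j ∈ t, w j * F j ^ 2
      ≤ w i * ∑ j ∈ t, w j * F j ^ 2 + w i * F i ^ 2 * ∑ j ∈ t, w j :=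
        le_add_of_nonneg_right <|
          mul_nonneg (mul_nonneg (hw i) (sq_nonneg _)) (sum_nonneg fun j _ => hw j)
    _ = w i * ∑ j ∈ t, w j * F j ^ 2 - 2 * w i * F i * ∑ j ∈ t, w j * F j +
          w i * F i ^ 2 * ∑ j ∈ t, w j := by rw [hF]; ring
    _ = ∑ j ∈ t, w i * w j * (F j - F i) ^ 2 := by
        simp only [mul_sum, ← sum_sub_distrib, ← sum_add_distrib]
        exact sum_congr rfl fun j _ => by ring

namespace IsWinding

variable {w : (J → Bool) → ℝ} {b : (J → Bool) → Finset (Finset J) → ℝ} (hb : IsWinding w b)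

include hb

lemma flip_support {M N : Finset (Finset J)} (hM : IsMatching M) (hN : N ⊆ M) (x : J → Bool) :
    b (flip x (support N)) M = b x M := by
  induction N using Finset.induction_on with
  | empty => rw [support_empty, flip_empty]
  | insert S N hSN ih =>
    obtain ⟨hSM, hNM⟩ := insert_subset_iff.1 hN
    rw [support_insert hM.1 hNM hSM hSN, ← flip_flip, hb.flip_block _ _ hM _ hSM, ih hNM]

lemma sum_mul_eq {x : J → Bool} {A : Finset (J → Bool)} (hA : ∀ y ∈ A, Even (diff x y).card)
    (G : (J → Bool) → ℝ) :
    ∑ y ∈ A, w x * w y * G y =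
      ∑ M ∈ matchings J with flip x (support M) ∈ A, b x M * G (flip x (support M)) := by
  have hmaps : ∀ M ∈ ({M ∈ matchings J | flip x (support M) ∈ A} : Finset _),
      support M ∈ ({D | flip x D ∈ A} : Finset (Finset J)) := fun M hM =>
    mem_filter.2 ⟨mem_univ _, (mem_filter.1 hM).2⟩
  rw [← sum_fiberwise_of_maps_to hmaps]
  refine (sum_equiv (flipEquiv x) (fun D => by simp [flipEquiv]) fun D hD => ?_).symm
  have hDA : flip x D ∈ A := (mem_filter.1 hD).2
  change _ = w x * w (flip x D) * G (flip x D)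
  rw [hb.mul_eq_sum x D (diff_flip x D ▸ hA _ hDA), sum_mul, filter_filter]
  refine sum_congr (filter_congr fun M _ => ?_) fun M hM => by rw [(mem_filter.1 hM).2]
  exact and_iff_right_of_imp fun h => h ▸ hDA

lemma sum_le_mul_sum (hw : ∀ x, 0 ≤ w x) (x : J → Bool) (R : Finset (J → Bool)) :
    ∑ M ∈ matchings J with flip x (support M) ∈ R, b x M ≤ w x * ∑ y ∈ R, w y := by
  have heven : ∀ y ∈ {y ∈ R | Even (diff x y).card}, Even (diff x y).card := fun y hy =>
    (mem_filter.1 hy).2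
  calc ∑ M ∈ matchings J with flip x (support M) ∈ R, b x M
      = ∑ M ∈ matchings J with flip x (support M) ∈ {y ∈ R | Even (diff x y).card},
          b x M * 1 := by
        refine sum_congr (filter_congr fun M hM => ?_) fun _ _ => (mul_one _).symm
        rw [mem_filter, diff_flip, and_iff_left (mem_matchings.1 hM).even_card_support]
    _ = ∑ y ∈ R with Even (diff x y).card, w x * w y * 1 := (hb.sum_mul_eq heven fun _ => 1).symm
    _ ≤ ∑ y ∈ R, w x * w y * 1 :=
        sum_le_sum_of_subset_of_nonneg (filter_subset _ _) fun y _ _ =>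
          mul_nonneg (mul_nonneg (hw x) (hw y)) zero_le_one
    _ = w x * ∑ y ∈ R, w y := by simp only [mul_one, mul_sum]

lemma sum_le_min_mul_sum (hw : ∀ x, 0 ≤ w x) (x : J → Bool) (S : Finset J)
    (R : Finset (J → Bool)) :
    ∑ M ∈ matchings J with
        S ∈ M ∧ flip x (support M) ∈ R ∧ flip (flip x S) (support M) ∈ R, b x M ≤
      min (w x) (w (flip x S)) * ∑ y ∈ R, w y := by
  rw [min_mul_of_nonneg _ _ (sum_nonneg fun y _ => hw y)]
  refine le_min (le_trans ?_ (hb.sum_le_mul_sum hw x R))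
    (le_trans ?_ (hb.sum_le_mul_sum hw (flip x S) R))
  · exact sum_le_sum_of_subset_of_nonneg (monotone_filter_right _ fun M _ h => h.2.1)
      fun M _ _ => hb.nonneg x M
  · have hflip : ∀ M ∈ matchings J, S ∈ M → b x M = b (flip x S) M := fun M hM hS =>
      (hb.flip_block x M (mem_matchings.1 hM) S hS).symm
    rw [sum_congr rfl fun M hM => hflip M (mem_filter.1 hM).1 (mem_filter.1 hM).2.1]
    exact sum_le_sum_of_subset_of_nonneg (monotone_filter_right _ fun M _ h => h.2.2)
      fun M _ _ => hb.nonneg _ M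

lemma sum_windingMoves_le (hw : ∀ x, 0 ≤ w x) (A R : Finset (J → Bool)) (F : (J → Bool) → ℝ) :
    ∑ M ∈ matchings J, ∑ S ∈ M, ∑ a ∈ windingMoves A R M S, b a M * (F (flip a S) - F a) ^ 2 ≤
      (∑ y ∈ R, w y) * moveEnergy w A F := by
  have hmoves : ∀ M ∈ matchings J,
      ∑ S ∈ M, ∑ a ∈ windingMoves A R M S, b a M * (F (flip a S) - F a) ^ 2 =
        ∑ a ∈ A, ∑ S ∈ M with
          flip a S ∈ A ∧ flip a (support M) ∈ R ∧ flip (flip a S) (support M) ∈ R,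
          b a M * (F (flip a S) - F a) ^ 2 :=
    fun M _ => sum_comm' fun S a => by simp only [windingMoves, mem_filter]; tauto
  calc _ = ∑ a ∈ A, ∑ S : Finset J with flip a S ∈ A ∧ S.card = 2,
        (∑ M ∈ matchings J with
          S ∈ M ∧ flip a (support M) ∈ R ∧ flip (flip a S) (support M) ∈ R, b a M) *
        (F (flip a S) - F a) ^ 2 := by
        simp only [sum_mul]
        rw [sum_congr rfl hmoves, sum_comm]
        refine sum_congr rfl fun a _ => sum_comm' fun M S => ?_
        simp only [mem_filter, mem_univ, true_and]
        refine ⟨fun h => ?_, by tauto⟩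
        have := (mem_matchings.1 h.1).2 S h.2.1
        tauto
    _ ≤ ∑ a ∈ A, ∑ S : Finset J with flip a S ∈ A ∧ S.card = 2,
        (min (w a) (w (flip a S)) * ∑ y ∈ R, w y) * (F (flip a S) - F a) ^ 2 :=
        sum_le_sum fun a _ => sum_le_sum fun S _ =>
          mul_le_mul_of_nonneg_right (hb.sum_le_min_mul_sum hw a S R) (sq_nonneg _)
    _ = (∑ y ∈ R, w y) * moveEnergy w A F := by
        rw [moveEnergy, mul_sum]
        refine sum_congr rfl fun a _ => ?_
        rw [mul_sum]
        refine sum_equiv (flipEquiv a) (fun S => ?_) fun S _ => ?_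
        · simp [flipEquiv, hammingDist_flip]
        · change _ = _ * (min (w a) (w (flip a S)) * (F (flip a S) - F a) ^ 2)
          ring

lemma mul_sq_sub_le {M : Finset (Finset J)} (hM : IsMatching M)
    {pre : Finset J → Finset (Finset J)} (hpre : IsWindingOrder M pre) (x : J → Bool)
    (F : (J → Bool) → ℝ) :
    b x M * (F (flip x (support M)) - F x) ^ 2 ≤ M.card * ∑ S ∈ M,
      b (flip x (support (pre S))) M *
        (F (flip (flip x (support (pre S))) S) - F (flip x (support (pre S)))) ^ 2 := by
  have hstep : ∀ S ∈ M, b (flip x (support (pre S))) M *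
        (F (flip (flip x (support (pre S))) S) - F (flip x (support (pre S)))) ^ 2 =
      b x M * (F (flip x (support (insert S (pre S)))) - F (flip x (support (pre S)))) ^ 2 := by
    intro S hS
    obtain ⟨hsub, hnot⟩ := subset_erase.1 (hpre.subset_erase S hS)
    rw [hb.flip_support hM hsub, flip_flip, support_insert hM.1 hsub hS hnot]
  have htele := hpre.telescope fun N => F (flip x (support N))
  rw [support_empty, flip_empty] at htele
  rw [← htele, sum_congr rfl hstep, ← mul_sum, mul_left_comm]
  exact mul_le_mul_of_nonneg_left sq_sum_le_card_mul_sum_sq (hb.nonneg x M)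

end IsWinding

end Flow

section LayerFlow

variable {E : Type*} [Fintype E] [DecidableEq E]

lemma flip_support_mem_windingMoves {M : Finset (Finset (E × Bool))} (hM : IsMatching M)
    (hle : (splitEdges (support M)).card ≤ 2) {S : Finset (E × Bool)} (hS : S ∈ M)
    {N : Finset (Finset (E × Bool))} (hN : N ⊆ M.erase S)
    (hNle : (splitEdges (support N)).card ≤ 2)
    (hSNle : (splitEdges (support (insert S N))).card ≤ 2) {z : Config E} (hz : z ∈ layer E 0) :
    flip z (support N) ∈ windingMoves (states E) (states E ∪ layer E 4) M S := by
  have hstates : ∀ K ⊆ M, (splitEdges (support K)).card ≤ 2 → flip z (support K) ∈ states E :=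
    fun K hK => (flip_mem_states_iff hz (hM.subset hK).even_card_support).2
  have hcompl : ∀ K ⊆ M, (splitEdges (support K)).card ≤ 2 →
      flip (flip z (support K)) (support M) ∈ states E ∪ layer E 4 := by
    intro K hK hKle
    have hsymm := card_splitEdges_symmDiff_le (support M) (support K)
    rw [flip_flip, symmDiff_comm, flip_mem_states_union_layer_iff hz]
    · omega
    · exact support_sdiff hM.1 hK ▸ (hM.subset sdiff_subset).even_card_support
  obtain ⟨hNM, hSN⟩ := subset_erase.1 hN
  have hSNM : insert S N ⊆ M := insert_subset hS hNM
  have hflip : flip (flip z (support N)) S = flip z (support (insert S N)) := by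
    rw [flip_flip, support_insert hM.1 hNM hS hSN]
  rw [windingMoves, mem_filter, hflip]
  exact ⟨hstates N hNM hNle, hstates _ hSNM hSNle, hcompl N hNM hNle, hcompl _ hSNM hSNle⟩

omit [DecidableEq E] in
lemma IsMatching.card_le_card_edges {M : Finset (Finset (E × Bool))} (hM : IsMatching M) :
    M.card ≤ Fintype.card E := by
  classical
  have := card_le_univ (support M)
  rw [hM.card_support, Fintype.card_prod, Fintype.card_bool] at this
  omega

lemma even_card_diff {x y : Config E} (hx : x ∈ layer E 0) (hy : Even (disagreements y)) :
    Even (diff x y).card := by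
  rwa [← even_card_splitEdges, ← disagreements_flip hx, flip_diff]

namespace IsWinding

variable {w : Config E → ℝ} {b : Config E → Finset (Finset (E × Bool)) → ℝ} (hb : IsWinding w b)

include hb

lemma sum_layer_zero_mul_sq_sub_le {M : Finset (Finset (E × Bool))} (hM : IsMatching M)
    (F : Config E → ℝ) :
    ∑ z ∈ layer E 0 with flip z (support M) ∈ states E,
        b z M * (F (flip z (support M)) - F z) ^ 2 ≤
      Fintype.card E * ∑ S ∈ M, ∑ a ∈ windingMoves (states E) (states E ∪ layer E 4) M S,
        b a M * (F (flip a S) - F a) ^ 2 := by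
  let energy S a := b a M * (F (flip a S) - F a) ^ 2
  have henergy : ∀ S a, 0 ≤ energy S a := fun S a => mul_nonneg (hb.nonneg a M) (sq_nonneg _)
  by_cases hle : (splitEdges (support M)).card ≤ 2
  · obtain ⟨pre, hpre, hprele⟩ := hM.exists_isWindingOrder hle
    calc _ ≤ ∑ z ∈ layer E 0 with flip z (support M) ∈ states E,
          Fintype.card E * ∑ S ∈ M, energy S (flip z (support (pre S))) := by
          refine sum_le_sum fun z _ => (hb.mul_sq_sub_le hM hpre z F).trans ?_
          refine mul_le_mul_of_nonneg_right ?_ (sum_nonneg fun S _ => henergy S _)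
          exact_mod_cast hM.card_le_card_edges
      _ = Fintype.card E * ∑ S ∈ M, ∑ z ∈ layer E 0 with flip z (support M) ∈ states E,
          energy S (flip z (support (pre S))) := by rw [← mul_sum, sum_comm]
      _ ≤ _ := by
          gcongr with S hS
          refine sum_flip_le (fun z hz => ?_) (henergy S)
          exact flip_support_mem_windingMoves hM hle hS (hpre.subset_erase S hS) (hprele S hS).1
            (hprele S hS).2 (mem_filter.1 hz).1
  · rw [filter_false_of_mem fun z hz h => hle ((flip_mem_states_iff hz hM.even_card_support).1 h),
      sum_empty]
    exact mul_nonneg (Nat.cast_nonneg _) (sum_nonneg fun S _ => sum_nonneg fun a _ => henergy S a)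

lemma sum_layer_zero_mul_states_le (hw : ∀ x, 0 ≤ w x) (F : Config E → ℝ) :
    ∑ z ∈ layer E 0, ∑ y ∈ states E, w z * w y * (F y - F z) ^ 2 ≤
      Fintype.card E * (∑ y ∈ states E ∪ layer E 4, w y) * moveEnergy w (states E) F := by
  have heven : ∀ z ∈ layer E 0, ∀ y ∈ states E, Even (diff z y).card := fun z hz y hy =>
    even_card_diff hz <| by rcases mem_states.1 hy with h | h <;> simp [h]
  calc _ = ∑ z ∈ layer E 0, ∑ M ∈ matchings (E × Bool) with flip z (support M) ∈ states E,
        b z M * (F (flip z (support M)) - F z) ^ 2 :=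
        sum_congr rfl fun z hz => hb.sum_mul_eq (heven z hz) fun y => (F y - F z) ^ 2
    _ = ∑ M ∈ matchings (E × Bool), ∑ z ∈ layer E 0 with flip z (support M) ∈ states E,
        b z M * (F (flip z (support M)) - F z) ^ 2 := by
        simp only [sum_filter]; exact sum_comm
    _ ≤ ∑ M ∈ matchings (E × Bool), Fintype.card E *
        ∑ S ∈ M, ∑ a ∈ windingMoves (states E) (states E ∪ layer E 4) M S,
          b a M * (F (flip a S) - F a) ^ 2 :=
        sum_le_sum fun M hM => hb.sum_layer_zero_mul_sq_sub_le (mem_matchings.1 hM) F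
    _ ≤ _ := by
        rw [← mul_sum, mul_assoc]
        gcongr
        exact hb.sum_windingMoves_le hw _ _ F

-- Flipping a part of `M` that splits two edges turns a pair in `Ω₀ × Ω₄` into one in `Ω₂ × Ω₂`.
lemma sum_layer_zero_le {M : Finset (Finset (E × Bool))} (hM : IsMatching M) :
    ∑ x ∈ layer E 0 with flip x (support M) ∈ layer E 4, b x M ≤
      ∑ x ∈ layer E 2 with flip x (support M) ∈ layer E 2, b x M := by
  by_cases hcard : (splitEdges (support M)).card = 4
  · obtain ⟨K, hKM, hK, hMK⟩ := hM.exists_subset_card_splitEdges hcard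
    rw [sum_congr rfl fun x _ => (hb.flip_support hM hKM x).symm]
    refine sum_flip_le (g := fun x => b x M) (fun x hx => mem_filter.2 ?_) fun x => hb.nonneg x M
    have hx := (mem_filter.1 hx).1
    rw [flip_flip, symmDiff_comm, ← support_sdiff hM.1 hKM, flip_mem_layer_iff hx,
      flip_mem_layer_iff hx]
    exact ⟨hK, hMK⟩
  · rw [filter_false_of_mem fun x hx h => hcard ((flip_mem_layer_iff hx _ _).1 h), sum_empty]
    exact sum_nonneg fun x _ => hb.nonneg x M

lemma sum_layer_zero_mul_sum_layer_four_le (hw : ∀ x, 0 ≤ w x) :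
    (∑ x ∈ layer E 0, w x) * (∑ y ∈ layer E 4, w y) ≤ (∑ x ∈ layer E 2, w x) ^ 2 := by
  have heven : ∀ x ∈ layer E 0, ∀ y ∈ layer E 4, Even (diff x y).card := fun x hx y hy =>
    even_card_diff hx <| by rw [mem_layer.1 hy]; decide
  calc _ = ∑ x ∈ layer E 0, ∑ y ∈ layer E 4, w x * w y * 1 := by simp only [sum_mul_sum, mul_one]
    _ = ∑ x ∈ layer E 0, ∑ M ∈ matchings (E × Bool) with flip x (support M) ∈ layer E 4,
        b x M := by
        refine sum_congr rfl fun x hx => ?_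
        rw [hb.sum_mul_eq (heven x hx) fun _ => 1]
        simp only [mul_one]
    _ = ∑ M ∈ matchings (E × Bool), ∑ x ∈ layer E 0 with flip x (support M) ∈ layer E 4,
        b x M := by simp only [sum_filter]; exact sum_comm
    _ ≤ ∑ M ∈ matchings (E × Bool), ∑ x ∈ layer E 2 with flip x (support M) ∈ layer E 2,
        b x M := sum_le_sum fun M hM => hb.sum_layer_zero_le (mem_matchings.1 hM)
    _ = ∑ x ∈ layer E 2, ∑ M ∈ matchings (E × Bool) with flip x (support M) ∈ layer E 2,
        b x M := by simp only [sum_filter]; exact sum_comm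
    _ ≤ ∑ x ∈ layer E 2, w x * ∑ y ∈ layer E 2, w y :=
        sum_le_sum fun x _ => hb.sum_le_mul_sum hw x _
    _ = (∑ x ∈ layer E 2, w x) ^ 2 := by rw [← sum_mul, sq]

lemma sq_mul_sum_states_le (hw : ∀ x, 0 ≤ w x) {F : Config E → ℝ}
    (hF : ∑ y ∈ states E, w y * F y = 0) :
    (∑ x ∈ layer E 0, w x) ^ 2 * ∑ y ∈ states E, w y * F y ^ 2 ≤
      Fintype.card E * (∑ y ∈ states E, w y) ^ 2 * moveEnergy w (states E) F := by
  set Z := fun k => ∑ x ∈ layer E k, w x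
  have hZ : ∀ k, 0 ≤ Z k := fun k => sum_nonneg fun x _ => hw x
  have hstates : ∑ y ∈ states E, w y = Z 0 + Z 2 :=
    sum_union (disjoint_layer (by decide))
  have hsum : ∑ y ∈ states E ∪ layer E 4, w y = Z 0 + Z 2 + Z 4 := by
    rw [sum_union, hstates]
    exact disjoint_union_left.2 ⟨disjoint_layer (by decide), disjoint_layer (by decide)⟩
  have hfour : Z 0 * (Z 0 + Z 2 + Z 4) ≤ (Z 0 + Z 2) ^ 2 := by
    nlinarith [hb.sum_layer_zero_mul_sum_layer_four_le hw, mul_nonneg (hZ 0) (hZ 2)]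
  calc Z 0 ^ 2 * ∑ y ∈ states E, w y * F y ^ 2
      = Z 0 * (Z 0 * ∑ y ∈ states E, w y * F y ^ 2) := by ring
    _ ≤ Z 0 * (Fintype.card E * (Z 0 + Z 2 + Z 4) * moveEnergy w (states E) F) := by
        rw [← hsum]
        exact mul_le_mul_of_nonneg_left
          ((sum_mul_sum_mul_sq_le hw _ _ hF).trans (hb.sum_layer_zero_mul_states_le hw F)) (hZ 0)
    _ = Fintype.card E * (Z 0 * (Z 0 + Z 2 + Z 4)) * moveEnergy w (states E) F := by ring
    _ ≤ Fintype.card E * (∑ y ∈ states E, w y) ^ 2 * moveEnergy w (states E) F := by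
        rw [hstates]
        gcongr
        exact moveEnergy_nonneg hw _ F

end IsWinding

end LayerFlow

namespace Instance

variable {V E : Type*} [Fintype V] (Λ : Instance V E)

lemma weight_nonneg (σ : Config E) : 0 ≤ Λ.weight σ :=
  prod_nonneg fun v _ => Λ.f_nonneg v _

lemma weight_mul_min (σ π : Config E) :
    Λ.weight σ * min 1 (Λ.weight π / Λ.weight σ) = min (Λ.weight σ) (Λ.weight π) := by
  rcases (Λ.weight_nonneg σ).eq_or_lt with hzero | hpos
  · rw [← hzero, zero_mul, min_eq_left (Λ.weight_nonneg π)]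
  · rw [mul_min_of_nonneg _ _ hpos.le, mul_one, mul_div_cancel₀ _ hpos.ne']

variable [Fintype E] [DecidableEq E]

lemma Z_nonneg (k : ℕ) : 0 ≤ Λ.Z k := sum_nonneg fun σ _ => Λ.weight_nonneg σ

lemma sum_state (g : Config E → ℝ) : ∑ σ : State E, g σ.1 = ∑ σ ∈ states E, g σ :=
  (sum_subtype (states E) (fun _ => mem_states) g).symm

lemma sum_weight_states : ∑ σ ∈ states E, Λ.weight σ = Λ.Z 0 + Λ.Z 2 :=
  sum_union (disjoint_layer (by decide))

lemma Z_add_Z_pos {σ : State E} (hσ : 0 < Λ.weight σ.1) : 0 < Λ.Z 0 + Λ.Z 2 := by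
  rw [← sum_weight_states]
  exact sum_pos' (fun π _ => Λ.weight_nonneg π) ⟨σ.1, mem_states.2 σ.2, hσ⟩

lemma μ_nonneg (σ : State E) : 0 ≤ Λ.μ σ :=
  div_nonneg (Λ.weight_nonneg _) (add_nonneg (Λ.Z_nonneg 0) (Λ.Z_nonneg 2))

lemma μ_dotProduct (F : Config E → ℝ) :
    Λ.μ ⬝ᵥ (fun σ => F σ.1) = (∑ σ ∈ states E, Λ.weight σ * F σ) / (Λ.Z 0 + Λ.Z 2) := by
  rw [← sum_state fun σ => Λ.weight σ * F σ, sum_div]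
  exact sum_congr rfl fun σ _ => div_mul_eq_mul_div _ _ _

lemma sum_μ (hZ : Λ.Z 0 + Λ.Z 2 ≠ 0) : ∑ σ, Λ.μ σ = 1 := by
  have := Λ.μ_dotProduct fun _ => 1
  simp only [mul_one, sum_weight_states, div_self hZ] at this
  rwa [← dotProduct_one]

lemma μΩ₀_eq : Λ.μΩ₀ = Λ.Z 0 / (Λ.Z 0 + Λ.Z 2) := by
  have hfilter : {σ ∈ states E | disagreements σ = 0} = layer E 0 := by
    ext σ
    rw [mem_filter, mem_states, mem_layer]
    tauto
  simp only [μΩ₀, μ, ← sum_div]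
  rw [sum_filter, sum_state fun σ => if disagreements σ = 0 then Λ.weight σ else 0, ← sum_filter,
    hfilter]
  rfl

lemma two_mul_card_hammingDist_eq_two_le (σ : State E) :
    2 * #{ρ : State E | hammingDist σ.1 ρ.1 = 2} ≤ numHalfEdges E ^ 2 := by
  have hchoose : #{ρ : State E | hammingDist σ.1 ρ.1 = 2} ≤ (numHalfEdges E).choose 2 := by
    rw [numHalfEdges, ← card_univ, ← card_powersetCard]
    refine card_le_card_of_injOn (fun ρ => diff σ.1 ρ.1) (fun ρ hρ => ?_) fun ρ _ ρ' _ h => ?_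
    · exact mem_powersetCard.2 ⟨subset_univ _, (mem_filter.1 hρ).2⟩
    · exact Subtype.ext ((flipEquiv σ.1).symm.injective h)
  calc 2 * #{ρ : State E | hammingDist σ.1 ρ.1 = 2}
      ≤ Nat.factorial 2 * (numHalfEdges E).choose 2 := Nat.mul_le_mul_left 2 hchoose
    _ = (numHalfEdges E).descFactorial 2 :=
        (Nat.descFactorial_eq_factorial_mul_choose _ 2).symm
    _ ≤ numHalfEdges E ^ 2 := Nat.descFactorial_le_pow _ 2

lemma metropolis_nonneg (σ π : State E) : 0 ≤ Λ.metropolis σ π := by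
  have hmin : ∀ ρ : State E, 0 ≤ min 1 (Λ.weight ρ.1 / Λ.weight σ.1) := fun ρ =>
    le_min zero_le_one (div_nonneg (Λ.weight_nonneg _) (Λ.weight_nonneg _))
  rw [metropolis]
  split_ifs
  · exact mul_nonneg (by positivity) (hmin π)
  · have hsum : ∑ ρ : State E with hammingDist σ.1 ρ.1 = 2, min 1 (Λ.weight ρ.1 / Λ.weight σ.1) ≤
        #{ρ : State E | hammingDist σ.1 ρ.1 = 2} :=
      (sum_le_card_nsmul _ _ 1 fun ρ _ => min_le_left _ _).trans (by simp)
    have hcard : (2 : ℝ) * #{ρ : State E | hammingDist σ.1 ρ.1 = 2} ≤ (numHalfEdges E : ℝ) ^ 2 :=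
      mod_cast two_mul_card_hammingDist_eq_two_le σ
    rw [sub_nonneg, div_mul_eq_mul_div]
    exact div_le_one_of_le₀ (by linarith) (by positivity)
  · exact le_rfl

lemma sum_metropolis (σ : State E) : ∑ π, Λ.metropolis σ π = 1 := by
  have hsplit : ∀ π, Λ.metropolis σ π =
      (if hammingDist σ.1 π.1 = 2 then
        2 / (numHalfEdges E : ℝ) ^ 2 * min 1 (Λ.weight π.1 / Λ.weight σ.1) else 0) +
      if σ = π then 1 - 2 / (numHalfEdges E : ℝ) ^ 2 *
        ∑ ρ : State E with hammingDist σ.1 ρ.1 = 2, min 1 (Λ.weight ρ.1 / Λ.weight σ.1)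
        else 0 := by
    intro π
    rw [metropolis]
    rcases eq_or_ne σ π with rfl | hne
    · simp [hammingDist_self]
    · simp [hne]
  rw [sum_congr rfl fun π _ => hsplit π, sum_add_distrib, sum_ite_eq, if_pos (mem_univ σ),
    ← sum_filter, ← mul_sum]
  ring

lemma weight_mul_metropolis {σ π : State E} (h : σ ≠ π) :
    Λ.weight σ.1 * Λ.metropolis σ π = if hammingDist σ.1 π.1 = 2 then
      2 / (numHalfEdges E : ℝ) ^ 2 * min (Λ.weight σ.1) (Λ.weight π.1) else 0 := by
  rw [metropolis, if_neg h, ← Λ.weight_mul_min]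
  split_ifs <;> ring

lemma isReversible_metropolis : IsReversible Λ.μ Λ.metropolis := by
  refine ⟨(Matrix.mem_rowStochastic_iff_sum).2 ⟨Λ.metropolis_nonneg, Λ.sum_metropolis⟩,
    fun σ π => ?_⟩
  rcases eq_or_ne σ π with rfl | h
  · rfl
  · rw [μ, μ, div_mul_eq_mul_div, div_mul_eq_mul_div, Λ.weight_mul_metropolis h,
      Λ.weight_mul_metropolis h.symm, hammingDist_comm, min_comm]

lemma lazyChain_eq : Λ.lazyChain = (1 / 2 : ℝ) • (1 + Λ.metropolis) := by
  ext σ π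
  simp only [lazyChain, Matrix.smul_apply, Matrix.add_apply, Matrix.one_apply, smul_eq_mul]
  split_ifs <;> ring

lemma isReversible_lazyChain : IsReversible Λ.μ Λ.lazyChain :=
  Λ.lazyChain_eq ▸ Λ.isReversible_metropolis.half_one_add

lemma dotProduct_mul_lazyChain_mulVec_nonneg (f : State E → ℝ) :
    0 ≤ Λ.μ ⬝ᵥ (f * Λ.lazyChain *ᵥ f) :=
  Λ.lazyChain_eq ▸ Λ.isReversible_metropolis.dotProduct_mul_mulVec_half_one_add_nonneg Λ.μ_nonneg f

lemma dirichletForm_lazyChain (F : Config E → ℝ) :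
    dirichletForm Λ.μ Λ.lazyChain (fun σ => F σ.1) =
      moveEnergy Λ.weight (states E) F /
        (2 * (numHalfEdges E : ℝ) ^ 2 * (Λ.Z 0 + Λ.Z 2)) := by
  have hmove : ∀ σ π : State E, Λ.μ σ * Λ.lazyChain σ π * (F π.1 - F σ.1) ^ 2 =
      (if hammingDist σ.1 π.1 = 2 then
        min (Λ.weight σ.1) (Λ.weight π.1) * (F π.1 - F σ.1) ^ 2 else 0) /
        ((numHalfEdges E : ℝ) ^ 2 * (Λ.Z 0 + Λ.Z 2)) := by
    intro σ π
    rcases eq_or_ne σ π with rfl | h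
    · simp
    · have hmul := Λ.weight_mul_metropolis h
      rw [μ, lazyChain, if_neg h, div_mul_div_comm, hmul]
      split_ifs
      · field_simp
      · simp
  have henergy : moveEnergy Λ.weight (states E) F = ∑ σ : State E, ∑ π : State E,
      if hammingDist σ.1 π.1 = 2 then
        min (Λ.weight σ.1) (Λ.weight π.1) * (F π.1 - F σ.1) ^ 2 else 0 := by
    rw [moveEnergy, ← sum_state]
    refine sum_congr rfl fun σ _ => ?_
    rw [sum_filter, ← sum_state]
  simp only [dirichletForm, hmove, henergy, ← sum_div]
  rw [mul_assoc 2, ← div_div _ 2, div_right_comm]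
  ring

variable [DecidableEq V] {Λ}

lemma poincareInequality_lazyChain (hΛ : ∀ v, Windable (Λ.f v)) (hZ : 0 < Λ.Z 0 + Λ.Z 2) :
    PoincareInequality Λ.μ Λ.lazyChain (Λ.μΩ₀ ^ 2 / (numHalfEdges E : ℝ) ^ 3) := by
  intro f hf
  obtain ⟨F, rfl⟩ : ∃ F : Config E → ℝ, f = fun σ => F σ.1 :=
    ⟨Function.extend Subtype.val f 0,
      funext fun σ => (Subtype.val_injective.extend_apply f 0 σ).symm⟩
  obtain ⟨b, hb⟩ := exists_isWinding Λ.endpoint hΛ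
  change IsWinding Λ.weight b at hb
  rw [μ_dotProduct, div_eq_zero_iff, or_iff_left hZ.ne'] at hf
  have hflow := hb.sq_mul_sum_states_le Λ.weight_nonneg hf
  change Λ.Z 0 ^ 2 * _ ≤ _ at hflow
  rw [sum_weight_states] at hflow
  have hn : (numHalfEdges E : ℝ) = Fintype.card E * 2 := by
    simp [numHalfEdges]
  rw [dirichletForm_lazyChain, μΩ₀_eq, hn]
  change _ * (Λ.μ ⬝ᵥ fun σ => F σ.1 ^ 2) ≤ _
  rw [Λ.μ_dotProduct fun σ => F σ ^ 2]
  rcases (Fintype.card E).eq_zero_or_pos with hE | hE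
  · simp [hE]
  · calc (Λ.Z 0 / (Λ.Z 0 + Λ.Z 2)) ^ 2 / ((Fintype.card E : ℝ) * 2) ^ 3 *
          ((∑ σ ∈ states E, Λ.weight σ * F σ ^ 2) / (Λ.Z 0 + Λ.Z 2))
        = Λ.Z 0 ^ 2 * (∑ σ ∈ states E, Λ.weight σ * F σ ^ 2) /
            (8 * (Fintype.card E : ℝ) ^ 3 * (Λ.Z 0 + Λ.Z 2) ^ 3) := by
          field_simp
          ring
      _ ≤ Fintype.card E * (Λ.Z 0 + Λ.Z 2) ^ 2 * moveEnergy Λ.weight (states E) F /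
            (8 * (Fintype.card E : ℝ) ^ 3 * (Λ.Z 0 + Λ.Z 2) ^ 3) := by gcongr
      _ = moveEnergy Λ.weight (states E) F /
            (2 * ((Fintype.card E : ℝ) * 2) ^ 2 * (Λ.Z 0 + Λ.Z 2)) := by
          field_simp
          norm_num

theorem tvDist_lazyChain_pow_le (hΛ : ∀ v, Windable (Λ.f v)) {σ : State E}
    (hσ : 0 < Λ.weight σ.1) (t : ℕ) :
    tvDist ((Λ.lazyChain ^ t) σ) Λ.μ ≤ 1 / 2 * Λ.μ σ ^ (-(1 / 2) : ℝ) *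
      Real.exp (-(t * Λ.μΩ₀ ^ 2 / (numHalfEdges E : ℝ) ^ 3)) := by
  have hZ := Λ.Z_add_Z_pos hσ
  rw [mul_div_assoc]
  exact Λ.isReversible_lazyChain.tvDist_pow_le Λ.μ_nonneg (Λ.sum_μ hZ.ne')
    Λ.dotProduct_mul_lazyChain_mulVec_nonneg (poincareInequality_lazyChain hΛ hZ)
    (div_pos hσ hZ) t

end Instance

lemma div_natCast_pow_le_div_pow {a : ℝ} (ha : 0 ≤ a) (n : ℕ) {k l : ℕ} (hk : k ≠ 0) (hkl : k ≤ l) :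
    a / (n : ℝ) ^ l ≤ a / (n : ℝ) ^ k := by
  rcases n.eq_zero_or_pos with rfl | hn
  · simp [hk, show l ≠ 0 by omega]
  · have : (1 : ℝ) ≤ n := mod_cast hn
    gcongr

end Holant

theorem mainTheorem1_general {V E : Type*} [Fintype V] [DecidableEq V] [Fintype E] [DecidableEq E]
    (Λ : Holant.Instance V E) (hΛ : ∀ v, Holant.Windable (Λ.f v)) :
    ((∀ σ π, 0 ≤ Λ.lazyChain σ π) ∧ (∀ σ, ∑ π, Λ.lazyChain σ π = 1) ∧
      Λ.μ ᵥ* Λ.lazyChain = Λ.μ) ∧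
    ∀ σ : Holant.State E, 0 < Λ.weight σ.1 → ∀ t : ℕ,
      Holant.tvDist ((Λ.lazyChain ^ t) σ) Λ.μ ≤
        (1 / 2) * Λ.μ σ ^ (-(1 / 2) : ℝ) *
          Real.exp (-(t * Λ.μΩ₀ ^ 2 / (Holant.numHalfEdges E : ℝ) ^ 3)) := by
  have hrev := Λ.isReversible_lazyChain
  obtain ⟨hnonneg, hsum⟩ := Matrix.mem_rowStochastic_iff_sum.1 hrev.stochastic
  exact ⟨⟨hnonneg, hsum, hrev.vecMul_eq⟩, fun σ hσ t =>
    Holant.Instance.tvDist_lazyChain_pow_le hΛ hσ t⟩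

theorem mainTheorem1 {V E : Type*} [Fintype V] [DecidableEq V] [Fintype E] [DecidableEq E]
    (Λ : Holant.Instance V E) (hΛ : ∀ v, Holant.Windable (Λ.f v)) :
    ((∀ σ π, 0 ≤ Λ.lazyChain σ π) ∧ (∀ σ, ∑ π, Λ.lazyChain σ π = 1) ∧
      Λ.μ ᵥ* Λ.lazyChain = Λ.μ) ∧
    ∀ σ : Holant.State E, 0 < Λ.weight σ.1 → ∀ t : ℕ,
      Holant.tvDist ((Λ.lazyChain ^ t) σ) Λ.μ ≤
        (1 / 2) * Λ.μ σ ^ (-(1 / 2) : ℝ) *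
          Real.exp (-(t * Λ.μΩ₀ ^ 2 / (Holant.numHalfEdges E : ℝ) ^ 4)) := by
  refine (mainTheorem1_general Λ hΛ).imp_right fun h σ hσ t => (h σ hσ t).trans ?_
  have := Λ.μ_nonneg σ
  gcongr _ * Real.exp (-?_)
  exact Holant.div_natCast_pow_le_div_pow (by positivity) _ (by decide) (by decide)
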